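/- Let $p>q$ be prime numbers, let $e$ be the least positive integer with $p^e\equiv 1\pmod q$, let $g\ge 1$ and $n=gq+1$, and assume $p^e>n$ and $p\ge n+q-2$. Write $z=(z_1,\dots,z_n)$. For $s\ge 1$ put $$\Phi_s(t,z)=\big((t-z_1)\cdots(t-z_n)\big)^{(p^{es}-1)/q}\in\mathbb Z[z][t],$$ let $A(\Phi_s)$ be the $g\times g$ matrix with entries in $\mathbb Z[z]$ whose $(u,v)$ entry, $1\le u,v\le g$, is the coefficient of $t^{p^{es}v-u}$ in $\Phi_s$, and let $I_s$ be the $n\times g$ matrix with entries in $\mathbb Z[z]$ whose $(j,\ell)$ entry, $1\le j\le n$, $1\le \ell\le g$, is the coefficient of $t^{\ell p^{es}-1}$ in $\Phi_s(t,z)/(t-z_j)$. Let $m\ge 1$, let $\mathbb Q_p^{(m)}$ be the unramified extension of $\mathbb Q_p$ of degree $m$ in a fixed algebraic closure, with the norm $|\cdot|_p$ extending the $p$-adic norm, and let $\mathbb Z_p^{(m)}=\{x\in\mathbb Q_p^{(m)}: |x|_p\le 1\}$. Let $$\mathfrak D^{(m)}_{KZ}=\{a\in(\mathbb Z_p^{(m)})^n:\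 |\det A(\Phi_1)(a)|_p=1\},$$ which is a union of open unit polydiscs $\{z : |z_j-a_j|_p<1,\ j=1,\dots,n\}$. A function on $\mathfrak D^{(m)}_{KZ}$ is called analytic if on each of these polydiscs it is given by a convergent power series. Then $|\det A(\Phi_s)(a)|_p=1$ for all $s\ge1$ and $a\in\mathfrak D^{(m)}_{KZ}$, so that the entries of the matrices below are rational functions of $z$ regular on $\mathfrak D^{(m)}_{KZ}$. For every $i=1,\dots,n$ the sequences $$\Big(\frac{\partial A(\Phi_s)}{\partial z_i}\cdot A(\Phi_s)^{-1}\Big)_{s\ge1},\qquad \big(I_s\cdot A(\Phi_s)^{-1}\big)_{s\ge1},\qquad \Big(\frac{\partial I_s}{\partial z_i}\cdot A(\Phi_s)^{-1}\Big)_{s\ge1}$$ converge uniformly on $\mathfrak D^{(m)}_{KZ}$, as $s\to\infty$, to analytic matrix-valued functions $\mathcal A^{(i)}$ (of size $g\times g$), $\mathcal I$ and $\mathcal I^{(i)}$ (of size $n\times g$) respectively, and on $\mathfrak D^{(m)}_{KZ}$ $$\frac{\partial \mathcal I}{\partial z_i}=\mathcal I^{(i)}-\mathcal I\cdot\mathcal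 A^{(i)}\qquad (i=1,\dots,n).$$ -/

import Mathlib

noncomputable section

namespace KZ

open Polynomial

/-- The unramified extension of degree `m ≥ 1` of `ℚ_[p]` inside the algebraic closure
`PadicAlgCl p` (whose norm extends the `p`-adic norm): it is obtained by attaching
a primitive root of unity of order `p ^ m - 1`. -/
def unramifiedExt (p : ℕ) [Fact p.Prime] (m : ℕ) : IntermediateField ℚ_[p] (PadicAlgCl p) :=
  IntermediateField.adjoin ℚ_[p] {ζ : PadicAlgCl p | IsPrimitiveRoot ζ (p ^ m - 1)}

/-- The master polynomial `Φ_s(t, z) = ((t - z_1) ⋯ (t - z_n)) ^ ((p ^ (e s) - 1) / q)`,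
as a polynomial in `t` with coefficients in `ℤ[z_1, …, z_n]`. -/
def masterPoly (n p q e s : ℕ) : (MvPolynomial (Fin n) ℤ)[X] :=
  (∏ i : Fin n, (X - C (MvPolynomial.X i))) ^ ((p ^ (e * s) - 1) / q)

/-- The Hasse--Witt matrix `A(Φ_s) = (Coeff_{p ^ (e s) v - u} Φ_s)`, `u, v = 1, …, g`.
The indices `u, v : Fin g` stand for `u + 1, v + 1`; for `g ≤ p ^ (e s)` the subtraction
does not truncate. -/
def hasseWitt (n g p q e s : ℕ) : Matrix (Fin g) (Fin g) (MvPolynomial (Fin n) ℤ) :=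
  Matrix.of fun u v =>
    (masterPoly n p q e s).coeff (p ^ (e * s) * ((v : ℕ) + 1) - ((u : ℕ) + 1))

/-- The `n × g` matrix `I_s`: the entry in row `i` and column `ℓ = 1, …, g` is the coefficient of
`t ^ (ℓ p ^ (e s) - 1)` in the polynomial `Φ_s(t, z) / (t - z_i)`. The index `l : Fin g`
stands for `ℓ = l + 1`. -/
def solMatrix (n g p q e s : ℕ) : Matrix (Fin n) (Fin g) (MvPolynomial (Fin n) ℤ) :=
  Matrix.of fun i l =>
    (masterPoly n p q e s /ₘ (X - C (MvPolynomial.X i))).coeff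
      (((l : ℕ) + 1) * p ^ (e * s) - 1)

/-- For `s ≥ 1` (that is, for a positive exponent) the division in `solMatrix` is exact. -/
theorem masterPoly_div_mul (n p q e s : ℕ) (h : 0 < (p ^ (e * s) - 1) / q) (i : Fin n) :
    (X - C (MvPolynomial.X i)) * (masterPoly n p q e s /ₘ (X - C (MvPolynomial.X i))) =
      masterPoly n p q e s := by
  rw [mul_divByMonic_eq_iff_isRoot, IsRoot.def, masterPoly, eval_pow, eval_prod,
    Finset.prod_eq_zero (Finset.mem_univ i) (by simp), zero_pow h.ne']

/-- The entrywise partial derivative `∂ / ∂ z_i` of a matrix of polynomials in `z`. -/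
def matPDeriv {n : ℕ} {ι κ : Type} (i : Fin n) (M : Matrix ι κ (MvPolynomial (Fin n) ℤ)) :
    Matrix ι κ (MvPolynomial (Fin n) ℤ) :=
  M.map (MvPolynomial.pderiv i)

/-- The value at the point `a` of a matrix of polynomials in `z`. -/
def matEval {n : ℕ} {ι κ K : Type} [Field K] (M : Matrix ι κ (MvPolynomial (Fin n) ℤ))
    (a : Fin n → K) : Matrix ι κ K :=
  M.map (MvPolynomial.aeval a)

/-- The domain of points `a` with coordinates in the ring of integers of `unramifiedExt p m`
such that `|det A(Φ_1)(a)| = 1`. -/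
def domain (n g p q e m : ℕ) [Fact p.Prime] : Set (Fin n → unramifiedExt p m) :=
  {a | (∀ j, ‖a j‖ ≤ 1) ∧ ‖(matEval (hasseWitt n g p q e 1) a).det‖ = 1}

/-- A matrix function is analytic on a set `D` of points that is a union of open unit polydiscs:
on each of these polydiscs, which are the balls of radius `1` for the sup norm
with a centre in `D`, each entry is the sum of a convergent power series. -/
def AnalyticOnUnitPolydiscs {n : ℕ} {ι κ K : Type} [NontriviallyNormedField K]
    (D : Set (Fin n → K)) (F : (Fin n → K) → Matrix ι κ K) : Prop :=
  ∀ a ∈ D, ∀ k l, ∃ P : FormalMultilinearSeries K (Fin n → K) K,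
    HasFPowerSeriesOnBall (fun z => F z k l) P a 1

end KZ

end

/-! Put P = p^e, Q = ∏ (t - z_j), N = (P - 1)/q and F = Q^N. Since (P^s - 1)/q = N(1 + P + ... +
P^(s-1)), Φ_s is F times the tower F^P F^(P^2) ... F^(P^(s-1)). Dividing by t - z_j or
differentiating in z_i can be made to affect only the head of this product, up to an integer scalar
that is p-adically Cauchy in s. So every row of the matrices in question is a scalar times c_s(E),
the vector of coefficients of E · tower at P^s, ..., gP^s, with E independent of s. The rows of A_s
= A(Φ_s) are the c_s(t^u F).

The core is the Dwork congruence c_{s+1}(E) A_{s+1}⁻¹ ≡ c_s(E) A_s⁻¹ mod p^s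
(`coeffVec_succ_congr`). By `coeffLinear`, after multiplying E · tower by any P^s-th power, the
coefficients at multiples of P^s depend mod p^s only on c_s(E), and linearly. For the power F^(P^s)
this says c_{s+1}(E) ≡ c_s(E) X with X independent of E; hence also A_{s+1} ≡ A_s X, and X cancels.
Every A_s is invertible because modulo p it is a product of Frobenius twists of A_1
(`isUnit_det_coeffMatrix`).

All this works over any commutative ring R in which p is a nonzerodivisor, 1 + pR consists of units
and det A_1 is a unit. Over the valuation ring O it gives pointwise limits with uniform error |p|^s.
Over O[[z]], at the point a + z, it gives a limit series with coefficients in O, which converges on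
the open unit polydisc; comparison mod p^s identifies the two limits (`exists_analytic_limit`).

For the differential equation, I_s A_s⁻¹ is expanded to first order in an increment t of z_i. The
remainder is t² times an integral matrix, a bound uniform in s, so the quotient rule survives the
limit (`hasDerivAt_limit`). -/

noncomputable section

namespace KZ

open Polynomial

/-! ### Divisibility of coefficients of powers, and linear algebra of coefficient vectors. -/

section Dwork

variable {R : Type*} [CommRing R]

/-- In a `P`-th power tower, the coefficient of `t ^ k` is highly divisible by `p` unless `k` is. -/
theorem exists_dvd_coeff_pow {p e : ℕ} (hp : p.Prime) (he : 0 < e)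
    (hreg : ∀ x : R, (p : R) * x = 0 → x = 0) (G : R[X]) (s k : ℕ) :
    ∃ b ≤ s, (p ^ e) ^ b ∣ k ∧ (p : R) ^ (s - b) ∣ (G ^ ((p ^ e) ^ s)).coeff k := by
  rcases Nat.eq_zero_or_pos k with rfl | hk
  · exact ⟨s, le_rfl, dvd_zero _, by simp⟩
  obtain ⟨a, k', hk', rfl⟩ := Nat.exists_eq_pow_mul_and_not_dvd hk.ne' p hp.one_lt.ne'
  have hcop : Nat.Coprime p k' := (Nat.Prime.coprime_iff_not_dvd hp).2 hk'
  by_cases hsa : e * s ≤ a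
  · refine ⟨s, le_rfl, ?_, by simp⟩
    rw [← pow_mul]
    exact (pow_dvd_pow p hsa).mul_right _
  push Not at hsa
  have hcancel : ∀ (j : ℕ) (x : R), (p : R) ^ j * x = 0 → x = 0 := by
    intro j
    induction j with
    | zero => intro x hx; simpa using hx
    | succ j ih => intro x hx; exact ih x (hreg _ (by rw [← mul_assoc, ← pow_succ', hx]))
  set c := (G ^ ((p ^ e) ^ s)).coeff (p ^ a * k') with hc
  -- Coefficient of t^(k-1) in the derivative of G^(P^s): k·c is divisible by P^s, while k has
  -- p-adic valuation only a.
  have hder : ((p ^ a * k' : ℕ) : R) * c =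
      (p : R) ^ (e * s) * (G ^ ((p ^ e) ^ s - 1) * derivative G).coeff (p ^ a * k' - 1) := by
    have h1 := coeff_derivative (G ^ ((p ^ e) ^ s)) (p ^ a * k' - 1)
    rw [derivative_pow, mul_assoc, coeff_C_mul] at h1
    have h2 : p ^ a * k' - 1 + 1 = p ^ a * k' := Nat.sub_add_cancel hk
    rw [h2, ← hc] at h1
    have h3 : ((p ^ a * k' - 1 : ℕ) : R) + 1 = ((p ^ a * k' : ℕ) : R) := by
      rw [← h2]; push_cast; simp
    rw [h3] at h1
    rw [mul_comm, ← h1]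
    push_cast
    rw [← pow_mul]
  have hdvd : (p : R) ^ (e * s - a) ∣ c := by
    set x := (G ^ ((p ^ e) ^ s - 1) * derivative G).coeff (p ^ a * k' - 1)
    have h4 : (k' : R) * c = (p : R) ^ (e * s - a) * x := by
      rw [← sub_eq_zero]
      apply hcancel a
      have h5 : (p : R) ^ (e * s) = (p : R) ^ a * (p : R) ^ (e * s - a) := by
        rw [← pow_add, Nat.add_sub_cancel' hsa.le]
      rw [h5] at hder
      push_cast at hder
      linear_combination hder
    have hcop2 : IsCoprime ((p : R) ^ (e * s - a)) (k' : R) := by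
      have h6 : IsCoprime ((p : ℤ)) (k' : ℤ) := Nat.isCoprime_iff_coprime.2 hcop
      have h7 := h6.map (Int.castRingHom R)
      simp only [eq_intCast, Int.cast_natCast] at h7
      exact h7.pow_left
    exact hcop2.dvd_of_dvd_mul_left ⟨x, h4⟩
  have hbs : a / e < s := by
    rw [Nat.div_lt_iff_lt_mul he, mul_comm]; exact hsa
  -- With b = ⌊a/e⌋ < s: es - a ≥ e(s - b) - (e - 1) ≥ s - b.
  refine ⟨a / e, hbs.le, ?_, (pow_dvd_pow _ ?_).trans hdvd⟩
  · rw [← pow_mul]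
    exact (pow_dvd_pow p (Nat.mul_div_le a e)).mul_right _
  · obtain ⟨r, hr⟩ := Nat.exists_eq_add_of_lt hbs
    have hmod := Nat.div_add_mod a e
    have hlt := Nat.mod_lt a he
    set b := a / e
    set m := a % e
    have h1 : s - b = r + 1 := by omega
    rw [h1]
    have h2 : e * s = e * b + e * r + e := by rw [hr]; ring
    have h3 : r ≤ e * r := Nat.le_mul_of_pos_left r he
    omega

/-- The product of the powers `F ^ (P ^ i)`, `1 ≤ i < s`. -/
def powTower (F : R[X]) (P s : ℕ) : R[X] := ∏ i ∈ Finset.Ico 1 s, F ^ (P ^ i)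

@[simp] theorem powTower_one (F : R[X]) (P : ℕ) : powTower F P 1 = 1 := by simp [powTower]

theorem powTower_succ (F : R[X]) (P : ℕ) {s : ℕ} (hs : 1 ≤ s) :
    powTower F P (s + 1) = powTower F P s * F ^ (P ^ s) := by
  rw [powTower, powTower, Finset.prod_Ico_succ_top hs]

theorem powTower_eq_mul_pow (F : R[X]) (P : ℕ) {b s : ℕ} (hb : 1 ≤ b) (hbs : b ≤ s) :
    ∃ T : R[X], powTower F P s = powTower F P b * T ^ (P ^ b) := by
  refine ⟨∏ i ∈ Finset.Ico b s, F ^ (P ^ (i - b)), ?_⟩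
  rw [powTower, powTower, ← Finset.prod_Ico_consecutive _ hb hbs, ← Finset.prod_pow]
  congr 1
  refine Finset.prod_congr rfl fun i hi => ?_
  rw [← pow_mul, ← pow_add, Nat.sub_add_cancel (Finset.mem_Ico.1 hi).1]

/-- The coefficients of `E ∏ F ^ (P ^ i)` at the multiples `P ^ s, 2 P ^ s, …, g P ^ s`. -/
def coeffVec (F : R[X]) (P g s : ℕ) (E : R[X]) : Fin g → R :=
  fun v => (E * powTower F P s).coeff (P ^ s * ((v : ℕ) + 1))

/-- The matrix whose rows are the coefficient vectors of `t F, t ^ 2 F, …, t ^ g F`. -/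
def coeffMatrix (F : R[X]) (P g s : ℕ) : Matrix (Fin g) (Fin g) R :=
  Matrix.of fun u => coeffVec F P g s (X ^ ((u : ℕ) + 1) * F)

/-- The bound reproduces itself: (g+1)P^s + P^s(g+1)(P-1) = (g+1)P^(s+1). It leaves only g positive
multiples of P^s where a coefficient can be nonzero. -/
theorem natDegree_mul_powTower_lt {F E : R[X]} {P g s : ℕ} (hP : 0 < P) (hs : 1 ≤ s)
    (hF : F.natDegree ≤ (g + 1) * (P - 1)) (hE : E.natDegree < (g + 1) * P) :
    (E * powTower F P s).natDegree < (g + 1) * P ^ s := by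
  induction s, hs using Nat.le_induction with
  | base => simpa using hE
  | succ s hs ih =>
    rw [powTower_succ F P hs, ← mul_assoc]
    refine natDegree_mul_le.trans_lt ?_
    have h1 : (F ^ (P ^ s)).natDegree ≤ P ^ s * ((g + 1) * (P - 1)) :=
      natDegree_pow_le.trans (Nat.mul_le_mul_left _ hF)
    have h2 : (g + 1) * P ^ (s + 1) = (g + 1) * P ^ s + P ^ s * ((g + 1) * (P - 1)) := by
      obtain ⟨Q, rfl⟩ : ∃ Q, P = Q + 1 := ⟨P - 1, by omega⟩
      simp only [Nat.add_sub_cancel]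
      ring
    omega

/-- Outside of the range of `coeffVec`, the coefficients at multiples of `P ^ s` vanish. -/
theorem exists_coeff_eq_dotProduct (g : ℕ) {P s : ℕ} (hP : 0 < P) (F : R[X]) (hs : 1 ≤ s)
    (hF : F.natDegree ≤ (g + 1) * (P - 1)) (w : ℕ) :
    ∃ x : Fin g → R, (∀ i, x i = if (i : ℕ) + 1 = w then 1 else 0) ∧ ∀ E : R[X], E.coeff 0 = 0 →
      E.natDegree < (g + 1) * P →
      (E * powTower F P s).coeff (P ^ s * w) = coeffVec F P g s E ⬝ᵥ x := by
  refine ⟨fun i => if (i : ℕ) + 1 = w then 1 else 0, fun i => rfl, fun E hE0 hE => ?_⟩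
  rcases Nat.eq_zero_or_pos w with rfl | hw
  · simp [mul_coeff_zero, hE0]
  by_cases hwg : w ≤ g
  · rw [dotProduct, Finset.sum_eq_single (⟨w - 1, by omega⟩ : Fin g)]
    · simp [coeffVec, Nat.sub_add_cancel hw]
    · intro i _ hi
      have : ¬ ((i : ℕ) + 1 = w) := fun h => hi (Fin.ext (by simp; omega))
      simp [this]
    · simp
  · rw [coeff_eq_zero_of_natDegree_lt, dotProduct, Finset.sum_eq_zero]
    · intro i _
      have : ¬ ((i : ℕ) + 1 = w) := by have := i.2; omega
      simp [this]
    · refine (natDegree_mul_powTower_lt hP hs hF hE).trans_le ?_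
      rw [mul_comm]
      exact Nat.mul_le_mul_left _ (by omega)

theorem coeffMatrix_row_coeff_zero (F : R[X]) (u : ℕ) : (X ^ (u + 1) * F).coeff 0 = 0 := by
  simp [mul_coeff_zero]

theorem coeffMatrix_row_natDegree {F : R[X]} {P g u : ℕ} (hP : 0 < P) (hu : u < g)
    (hF : F.natDegree ≤ (g + 1) * (P - 1)) : (X ^ (u + 1) * F).natDegree < (g + 1) * P := by
  refine natDegree_mul_le.trans_lt ?_
  have h1 := natDegree_X_pow_le (R := R) (u + 1)
  obtain ⟨Q, rfl⟩ : ∃ Q, P = Q + 1 := ⟨P - 1, by omega⟩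
  simp only [Nat.add_sub_cancel] at hF
  have : (g + 1) * (Q + 1) = (g + 1) * Q + g + 1 := by ring
  omega

/-- A coefficient congruence transfers to the matrices of rows. -/
theorem coeffVec_vecMul_inv_congr {F : R[X]} {P g s t : ℕ} (hP : 0 < P)
    (hF : F.natDegree ≤ (g + 1) * (P - 1)) {d : R} (X' : Matrix (Fin g) (Fin g) R)
    (hA : IsUnit (coeffMatrix F P g s).det) (hB : IsUnit (coeffMatrix F P g t).det)
    (h : ∀ E : R[X], E.coeff 0 = 0 → E.natDegree < (g + 1) * P →
      ∃ y : Fin g → R, coeffVec F P g t E = Matrix.vecMul (coeffVec F P g s E) X' + d • y)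
    (E : R[X]) (hE0 : E.coeff 0 = 0) (hE : E.natDegree < (g + 1) * P) :
    ∃ y : Fin g → R, Matrix.vecMul (coeffVec F P g t E) (coeffMatrix F P g t)⁻¹ =
      Matrix.vecMul (coeffVec F P g s E) (coeffMatrix F P g s)⁻¹ + d • y := by
  have hrow : ∀ u : Fin g, ∃ y : Fin g → R, coeffMatrix F P g t u =
      Matrix.vecMul (coeffMatrix F P g s u) X' + d • y := fun u =>
    h _ (coeffMatrix_row_coeff_zero F u) (coeffMatrix_row_natDegree hP u.2 hF)
  choose Y hY using hrow
  obtain ⟨y, hy⟩ := h E hE0 hE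
  set A := coeffMatrix F P g s
  set B := coeffMatrix F P g t
  set L := Matrix.vecMul (coeffVec F P g s E) A⁻¹
  have hmat : B = A * X' + d • Matrix.of Y := by
    ext u v
    simpa [Matrix.vecMul, Matrix.mul_apply, dotProduct] using congrFun (hY u) v
  have hLA : Matrix.vecMul L A = coeffVec F P g s E := by
    simp only [L, Matrix.vecMul_vecMul]
    rw [Matrix.nonsing_inv_mul _ hA, Matrix.vecMul_one]
  -- The vector of E at level t is L A X' + d y, and A X' = B - d Y; this eliminates X', which need
  -- not be invertible.
  have hLB : coeffVec F P g t E =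
      Matrix.vecMul L B + d • (y - Matrix.vecMul L (Matrix.of Y)) := by
    rw [hy, hmat, Matrix.vecMul_add, ← Matrix.vecMul_vecMul, hLA, Matrix.vecMul_smul, smul_sub]
    abel
  refine ⟨Matrix.vecMul (y - Matrix.vecMul L (Matrix.of Y)) B⁻¹, ?_⟩
  rw [hLB, Matrix.add_vecMul, Matrix.vecMul_vecMul, Matrix.mul_nonsing_inv _ hB, Matrix.vecMul_one,
    Matrix.smul_vecMul]

end Dwork

/-! ### The Dwork congruence and the invertibility of the matrices. -/

section Dwork

variable {R : Type*} [CommRing R]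

/-- The coefficients of `E_s G ^ (P ^ s)` at multiples of `P ^ s` depend linearly on `coeffVec`,
modulo `p ^ s`. -/
def CoeffLinear (p g P : ℕ) (F : R[X]) (s : ℕ) : Prop :=
  ∀ (G : R[X]) (w : ℕ), ∃ x : Fin g → R, ∀ E : R[X], E.coeff 0 = 0 → E.natDegree < (g + 1) * P →
    ∃ y : R, (E * powTower F P s * G ^ (P ^ s)).coeff (P ^ s * w) =
      coeffVec F P g s E ⬝ᵥ x + (p : R) ^ s * y

theorem CoeffLinear.succ_congr {p g P s : ℕ} {F : R[X]} (h : CoeffLinear p g P F s) (hs : 1 ≤ s)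
    (hP : 0 < P) (hF : F.natDegree ≤ (g + 1) * (P - 1))
    (hA : ∀ b, 1 ≤ b → IsUnit (coeffMatrix F P g b).det)
    (E : R[X]) (hE0 : E.coeff 0 = 0) (hE : E.natDegree < (g + 1) * P) :
    ∃ y : Fin g → R,
      Matrix.vecMul (coeffVec F P g (s + 1) E) (coeffMatrix F P g (s + 1))⁻¹ =
      Matrix.vecMul (coeffVec F P g s E) (coeffMatrix F P g s)⁻¹ + (p : R) ^ s • y := by
  -- The choice G = F adds the next factor of the tower, and P^s · P(v+1) = P^(s+1)(v+1).
  choose x hx using fun v : Fin g => h F (P * ((v : ℕ) + 1))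
  refine coeffVec_vecMul_inv_congr hP hF (Matrix.of fun i v => x v i) (hA s hs)
    (hA (s + 1) (by omega)) (fun E hE0 hE => ?_) E hE0 hE
  choose y hy using fun v : Fin g => hx v E hE0 hE
  refine ⟨y, funext fun v => ?_⟩
  have h1 := hy v
  rw [mul_assoc, ← powTower_succ F P hs, ← mul_assoc, ← pow_succ] at h1
  simpa [coeffVec, Matrix.vecMul, dotProduct] using h1

/-- Telescoping of the one-step congruences. Linearity is assumed only below level s, so that this
can be used inside the induction that proves linearity at level s. -/
theorem congr_of_le {p g P b s : ℕ} {F : R[X]} (hb : 1 ≤ b) (hbs : b ≤ s)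
    (h : ∀ i < s, 1 ≤ i → CoeffLinear p g P F i)
    (hP : 0 < P) (hF : F.natDegree ≤ (g + 1) * (P - 1))
    (hA : ∀ b, 1 ≤ b → IsUnit (coeffMatrix F P g b).det)
    (E : R[X]) (hE0 : E.coeff 0 = 0) (hE : E.natDegree < (g + 1) * P) :
    ∃ y : Fin g → R,
      Matrix.vecMul (coeffVec F P g s E) (coeffMatrix F P g s)⁻¹ =
      Matrix.vecMul (coeffVec F P g b E) (coeffMatrix F P g b)⁻¹ + (p : R) ^ b • y := by
  induction s, hbs using Nat.le_induction with
  | base => exact ⟨0, by simp⟩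
  | succ s hbs ih =>
    obtain ⟨y, hy⟩ := ih fun i hi h1 => h i (by omega) h1
    obtain ⟨z, hz⟩ := (h s (by omega) (hb.trans hbs)).succ_congr (hb.trans hbs) hP hF hA E hE0 hE
    obtain ⟨d, rfl⟩ := Nat.exists_eq_add_of_le hbs
    refine ⟨y + (p : R) ^ d • z, ?_⟩
    rw [hz, hy, smul_add, smul_smul, ← pow_add, add_assoc]

/-- Expand the coefficient as a sum over i + k = P^s w. If the coefficient of t^k in G^(P^s) is not
divisible by p^s, then k, hence i, is divisible by some P^b with b ≥ 1, and the missing p^b comes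
from linearity at the lower level b. -/
theorem coeffLinear {p e g : ℕ} (hp : p.Prime) (he : 0 < e)
    (hreg : ∀ x : R, (p : R) * x = 0 → x = 0) {F : R[X]}
    (hF : F.natDegree ≤ (g + 1) * (p ^ e - 1))
    (hA : ∀ b, 1 ≤ b → IsUnit (coeffMatrix F (p ^ e) g b).det) (s : ℕ) (hs : 1 ≤ s) :
    CoeffLinear p g (p ^ e) F s := by
  have hP : 0 < p ^ e := pow_pos hp.pos e
  set P := p ^ e with hPdef
  induction s using Nat.strong_induction_on with
  | _ s ih =>
  intro G w
  have key : ∀ ik : ℕ × ℕ, ik.1 + ik.2 = P ^ s * w → ∃ x : Fin g → R, ∀ E : R[X], E.coeff 0 = 0 →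
      E.natDegree < (g + 1) * P → ∃ y : R, (E * powTower F P s).coeff ik.1 *
        (G ^ (P ^ s)).coeff ik.2 = coeffVec F P g s E ⬝ᵥ x + (p : R) ^ s * y := by
    rintro ⟨i, k⟩ hik
    dsimp only at hik ⊢
    obtain ⟨b, hbs, hbk, c, hc⟩ := exists_dvd_coeff_pow hp he hreg G s k
    rw [← hPdef] at hc hbk
    have hbi : P ^ b ∣ i :=
      (Nat.dvd_add_left hbk).1 (hik ▸ (pow_dvd_pow P hbs).mul_right w)
    obtain ⟨w', rfl⟩ := hbi
    rw [hc]
    rcases Nat.eq_zero_or_pos b with rfl | hb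
    · exact ⟨0, fun E _ _ => ⟨(E * powTower F P s).coeff (P ^ 0 * w') * c, by simp; ring⟩⟩
    rcases hbs.lt_or_eq with hlt | rfl
    · obtain ⟨T, hT⟩ := powTower_eq_mul_pow F P hb hbs
      obtain ⟨x, hx⟩ := ih b hlt hb T w'
      -- Transport from level b to level s: c_b(E) x = (c_b(E) A_b⁻¹) A_b x ≡ (c_s(E) A_s⁻¹) A_b x
      -- mod p^b, and the factor p^(s-b) raises the modulus to p^s.
      refine ⟨((p : R) ^ (s - b) * c) • Matrix.mulVec (coeffMatrix F P g s)⁻¹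
        (Matrix.mulVec (coeffMatrix F P g b) x), fun E hE0 hE => ?_⟩
      obtain ⟨y, hy⟩ := hx E hE0 hE
      rw [mul_assoc, ← hT] at hy
      obtain ⟨z, hz⟩ := congr_of_le hb hbs (fun i hi h1 => ih i hi h1) hP hF hA E hE0 hE
      have h1 : coeffVec F P g s E ⬝ᵥ Matrix.mulVec (coeffMatrix F P g s)⁻¹
          (Matrix.mulVec (coeffMatrix F P g b) x) =
          coeffVec F P g b E ⬝ᵥ x + (p : R) ^ b * (z ⬝ᵥ Matrix.mulVec (coeffMatrix F P g b) x) := by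
        rw [Matrix.dotProduct_mulVec, hz, add_dotProduct, smul_dotProduct,
          ← Matrix.dotProduct_mulVec, Matrix.mulVec_mulVec, Matrix.nonsing_inv_mul _ (hA b hb),
          Matrix.one_mulVec, smul_eq_mul]
      refine ⟨c * (y - z ⬝ᵥ Matrix.mulVec (coeffMatrix F P g b) x), ?_⟩
      rw [hy, dotProduct_smul, h1, smul_eq_mul]
      have h2 : (p : R) ^ s = (p : R) ^ (s - b) * (p : R) ^ b := by
        rw [← pow_add, Nat.sub_add_cancel hbs]
      rw [h2]
      ring
    · obtain ⟨x, -, hx⟩ := exists_coeff_eq_dotProduct g hP F hs hF w'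
      refine ⟨c • x, fun E hE0 hE => ⟨0, ?_⟩⟩
      rw [hx E hE0 hE, dotProduct_smul]
      simp [mul_comm]
  choose! x hx using key
  refine ⟨∑ ik ∈ Finset.HasAntidiagonal.antidiagonal (P ^ s * w), x ik, fun E hE0 hE => ?_⟩
  have hx' := fun ik h => hx ik h E hE0 hE
  choose! y hy using hx'
  refine ⟨∑ ik ∈ Finset.HasAntidiagonal.antidiagonal (P ^ s * w), y ik, ?_⟩
  rw [coeff_mul, dotProduct_sum, Finset.mul_sum, ← Finset.sum_add_distrib]
  exact Finset.sum_congr rfl fun ik hik => hy ik (Finset.HasAntidiagonal.mem_antidiagonal.1 hik)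

/-- Dwork congruence for the normalized coefficient vectors. -/
theorem coeffVec_succ_congr {p e g : ℕ} (hp : p.Prime) (he : 0 < e)
    (hreg : ∀ x : R, (p : R) * x = 0 → x = 0) {F : R[X]}
    (hF : F.natDegree ≤ (g + 1) * (p ^ e - 1))
    (hA : ∀ b, 1 ≤ b → IsUnit (coeffMatrix F (p ^ e) g b).det) {s : ℕ} (hs : 1 ≤ s)
    (E : R[X]) (hE0 : E.coeff 0 = 0) (hE : E.natDegree < (g + 1) * p ^ e) :
    ∃ y : Fin g → R,
      Matrix.vecMul (coeffVec F (p ^ e) g (s + 1) E) (coeffMatrix F (p ^ e) g (s + 1))⁻¹ =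
      Matrix.vecMul (coeffVec F (p ^ e) g s E) (coeffMatrix F (p ^ e) g s)⁻¹ + (p : R) ^ s • y :=
  (coeffLinear hp he hreg hF hA s hs).succ_congr hs (pow_pos hp.pos e) hF hA E hE0 hE

theorem isUnit_of_isUnit_mk {p : R} (hp : ∀ x, IsUnit (1 + p * x)) {a : R}
    (ha : IsUnit (Ideal.Quotient.mk (Ideal.span {p}) a)) : IsUnit a := by
  obtain ⟨b, hb⟩ := ha.exists_right_inv
  obtain ⟨b, rfl⟩ := Ideal.Quotient.mk_surjective b
  rw [← map_mul, ← map_one (Ideal.Quotient.mk _), Ideal.Quotient.mk_eq_mk_iff_sub_mem,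
    Ideal.mem_span_singleton] at hb
  obtain ⟨x, hx⟩ := hb
  have h1 := hp x
  rw [← hx] at h1
  exact isUnit_of_mul_isUnit_left (y := b) (by convert h1 using 1; ring)

theorem coeffMatrix_map {S : Type*} [CommRing S] (φ : R →+* S) (F : R[X]) (P g s : ℕ) :
    (coeffMatrix F P g s).map φ = coeffMatrix (F.map φ) P g s := by
  ext u v
  have : (powTower F P s).map φ = powTower (F.map φ) P s := by
    simp [powTower, Polynomial.map_prod, Polynomial.map_pow]
  simp only [coeffMatrix, coeffVec, Matrix.map_apply, Matrix.of_apply]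
  rw [← coeff_map, Polynomial.map_mul, this]
  simp

/-- In characteristic `p` the matrices multiply up to a Frobenius twist. -/
theorem coeffMatrix_succ_charP {p : ℕ} [Fact p.Prime] [CharP R p] {e g s : ℕ} (hs : 1 ≤ s)
    (F : R[X]) (hF : F.natDegree ≤ (g + 1) * (p ^ e - 1)) :
    coeffMatrix F (p ^ e) g (s + 1) = coeffMatrix F (p ^ e) g s *
      (coeffMatrix F (p ^ e) g 1).map (iterateFrobenius R p (e * s)) := by
  have hP : 0 < p ^ e := pow_pos (Fact.out : p.Prime).pos e
  ext u v
  have hE0 := coeffMatrix_row_coeff_zero F u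
  have hE := coeffMatrix_row_natDegree hP u.2 hF
  rw [Matrix.mul_apply]
  simp only [coeffMatrix, Matrix.of_apply, Matrix.map_apply]
  -- In characteristic p this power is a polynomial in t^(P^s), so only the part of E · tower at
  -- multiples of P^s contributes; that part has just g terms.
  have h2 : F ^ ((p ^ e) ^ s) =
      expand R ((p ^ e) ^ s) (F.map (iterateFrobenius R p (e * s))) := by
    rw [← pow_mul, ← map_iterateFrobenius_expand, map_expand]
  set E := X ^ ((u : ℕ) + 1) * F
  set F' := F.map (iterateFrobenius R p (e * s))
  have h1 : coeffVec F (p ^ e) g (s + 1) E v =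
      (contract ((p ^ e) ^ s) (E * powTower F (p ^ e) s) * F').coeff
        (p ^ e * ((v : ℕ) + 1)) := by
    rw [← contract_mul_expand (pow_pos hP s).ne', coeff_contract (pow_pos hP s).ne', ← h2,
      mul_assoc, ← powTower_succ _ _ hs, coeffVec]
    congr 1
    ring
  have h3 : contract ((p ^ e) ^ s) (E * powTower F (p ^ e) s) =
      ∑ w : Fin g, C (coeffVec F (p ^ e) g s E w) * X ^ ((w : ℕ) + 1) := by
    ext k
    obtain ⟨x, hx, hx'⟩ := exists_coeff_eq_dotProduct g hP F hs hF k
    rw [coeff_contract (pow_pos hP s).ne', mul_comm k, hx' E hE0 hE, finsetSum_coeff, dotProduct]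
    refine Finset.sum_congr rfl fun w _ => ?_
    rw [hx, coeff_C_mul_X_pow]
    simp [eq_comm]
  rw [h1, h3, Finset.sum_mul, finsetSum_coeff]
  refine Finset.sum_congr rfl fun w _ => ?_
  rw [mul_assoc, coeff_C_mul, coeffVec.eq_1 F (p ^ e) g 1, powTower_one, mul_one, pow_one,
    ← coeff_map, Polynomial.map_mul, Polynomial.map_pow, map_X]

/-- Modulo p the determinant at level s + 1 is that at level s times a Frobenius power of the first
one; units lift because 1 + pR consists of units. -/
theorem isUnit_det_coeffMatrix {p e g : ℕ} (hp : p.Prime) 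
    (hjac : ∀ x : R, IsUnit (1 + (p : R) * x)) {F : R[X]}
    (hF : F.natDegree ≤ (g + 1) * (p ^ e - 1))
    (hA : IsUnit (coeffMatrix F (p ^ e) g 1).det) (s : ℕ) (hs : 1 ≤ s) :
    IsUnit (coeffMatrix F (p ^ e) g s).det := by
  rcases subsingleton_or_nontrivial R with hR | hR
  · exact isUnit_of_subsingleton _
  have : Fact p.Prime := ⟨hp⟩
  have : CharP (R ⧸ Ideal.span {(p : R)}) p := CharP.quotient R p (by
    intro h
    obtain ⟨x, hx⟩ := h.exists_right_inv
    have := hjac (-x)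
    rw [mul_neg, hx] at this
    simp at this)
  induction s, hs using Nat.le_induction with
  | base => exact hA
  | succ s hs ih =>
    apply isUnit_of_isUnit_mk hjac
    rw [RingHom.map_det, RingHom.mapMatrix_apply, coeffMatrix_map, coeffMatrix_succ_charP hs,
      Matrix.det_mul, ← coeffMatrix_map, ← coeffMatrix_map, ← RingHom.mapMatrix_apply,
      ← RingHom.mapMatrix_apply, ← RingHom.mapMatrix_apply, ← RingHom.map_det, ← RingHom.map_det,
      ← RingHom.map_det]
    · exact (ih.map _).mul ((hA.map _).map _)
    · exact natDegree_map_le.trans hF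

end Dwork

/-- A monomial of degree `k` is a product of `k` coordinates. -/
theorem exists_prod_coord_eq {K : Type*} [CommMonoid K] {n : ℕ} (k : ℕ) (d : Fin n →₀ ℕ) (hd : d.degree = k) :
    ∃ κ : Fin k → Fin n, ∀ y : Fin n → K, ∏ i, y (κ i) = d.prod fun j c => y j ^ c := by
  induction k generalizing d with
  | zero =>
    refine ⟨Fin.elim0, fun y => ?_⟩
    rw [(Finsupp.degree_eq_zero_iff d).1 hd]
    simp
  | succ k ih =>
    obtain ⟨j, hj⟩ : ∃ j, d j ≠ 0 := by
      by_contra! h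
      have : d = 0 := Finsupp.ext h
      simp [this] at hd
    have hle : Finsupp.single j 1 ≤ d := by
      simpa [Finsupp.single_le_iff] using Nat.one_le_iff_ne_zero.2 hj
    obtain ⟨d', rfl⟩ := exists_add_of_le hle
    obtain ⟨κ, hκ⟩ := ih d' (by simp at hd; omega)
    refine ⟨Fin.cons j κ, fun y => ?_⟩
    rw [Fin.prod_univ_succ, Finsupp.prod_add_index' (by simp) (by intros; rw [pow_add])]
    simp [hκ]

/-! ### The valuation ring, and power series over it as analytic functions. -/

section UnitBall

variable (K : Type*) [NontriviallyNormedField K] [IsUltrametricDist K]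

/-- The ring of integers of an ultrametric field. -/
def unitBall : Subring K where
  carrier := {x | ‖x‖ ≤ 1}
  mul_mem' {x y} hx hy := by
    simp only [Set.mem_ofPred_eq, norm_mul] at *
    exact mul_le_one₀ hx (norm_nonneg _) hy
  one_mem' := by simp
  add_mem' {x y} hx hy := (IsUltrametricDist.norm_add_le_max x y).trans (max_le hx hy)
  zero_mem' := by simp
  neg_mem' {x} hx := by simpa using hx

variable {K}

theorem mem_unitBall {x : K} : x ∈ unitBall K ↔ ‖x‖ ≤ 1 := Iff.rfl

theorem unitBall_norm_le (x : unitBall K) : ‖(x : K)‖ ≤ 1 := x.2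

theorem isUnit_unitBall_iff {x : unitBall K} : IsUnit x ↔ ‖(x : K)‖ = 1 := by
  constructor
  · intro h
    obtain ⟨y, hy⟩ := h.exists_right_inv
    have h1 : ‖(x : K)‖ * ‖(y : K)‖ = 1 := by
      rw [← norm_mul, ← Subring.coe_mul, hy]; simp
    have hx := unitBall_norm_le x
    have hy := unitBall_norm_le y
    nlinarith [norm_nonneg (x : K)]
  · intro h
    have hx : (x : K) ≠ 0 := by rw [← norm_ne_zero_iff, h]; exact one_ne_zero
    exact IsUnit.of_mul_eq_one ⟨(x : K)⁻¹, by simp [mem_unitBall, h]⟩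
      (Subtype.ext (mul_inv_cancel₀ hx))

theorem unitBall_dvd {c x : unitBall K} (hc : (c : K) ≠ 0) (h : ‖(x : K)‖ ≤ ‖(c : K)‖) : c ∣ x := by
  refine ⟨⟨(x : K) / c, ?_⟩, Subtype.ext ?_⟩
  · rw [mem_unitBall, norm_div]
    exact div_le_one_of_le₀ h (norm_nonneg _)
  · simp [mul_div_cancel₀ _ hc]

theorem unitBall_norm_mul_le (c x : unitBall K) : ‖((c * x : unitBall K) : K)‖ ≤ ‖(c : K)‖ := by
  rw [Subring.coe_mul, norm_mul]
  exact mul_le_of_le_one_right (norm_nonneg _) x.2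

instance : IsLinearTopology (unitBall K) (unitBall K) := by
  -- The absolute value makes this an ideal for every real r, negative ones included.
  let I : ℝ → Ideal (unitBall K) := fun r =>
    { carrier := {x | ‖(x : K)‖ ≤ |r|}
      add_mem' := fun {x y} hx hy =>
        (IsUltrametricDist.norm_add_le_max (x : K) y).trans (max_le hx hy)
      zero_mem' := by simp
      smul_mem' := fun c x hx => by
        rw [smul_eq_mul, mul_comm]
        exact (unitBall_norm_mul_le x c).trans hx }
  refine IsLinearTopology.mk_of_hasBasis (unitBall K) (p := fun r : ℝ => 0 < r) (s := I) ?_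
  refine (Metric.nhds_basis_closedBall (x := (0 : unitBall K))).congr (fun _ => Iff.rfl)
    fun r hr => ?_
  ext x
  simp [I, abs_of_pos hr]

instance [CompleteSpace K] : CompleteSpace (unitBall K) := by
  have : IsClosed ((unitBall K : Subring K) : Set K) := isClosed_le continuous_norm continuous_const
  exact this.completeSpace_coe

theorem hasEval_of_norm_lt_one {n : ℕ} {y : Fin n → unitBall K} (hy : ∀ j, ‖(y j : K)‖ < 1) :
    MvPowerSeries.HasEval y where
  hpow j := by
    rw [IsTopologicallyNilpotent, tendsto_subtype_rng]
    simpa using tendsto_pow_atTop_nhds_zero_of_norm_lt_one (hy j)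
  tendsto_zero := by simp [Filter.cofinite_eq_bot]

/-- A power series with integral coefficients defines an analytic function on the open
unit polydisc. -/
theorem hasFPowerSeriesOnBall_of_aeval [CompleteSpace K] {n : ℕ}
    (φ : MvPowerSeries (Fin n) (unitBall K)) (f : (Fin n → K) → K) (a : Fin n → K)
    (h : ∀ (y : Fin n → unitBall K) (hy : ∀ j, ‖(y j : K)‖ < 1),
      f (a + fun j => (y j : K)) = (MvPowerSeries.aeval (hasEval_of_norm_lt_one hy) φ : K)) :
    ∃ P : FormalMultilinearSeries K (Fin n → K) K, HasFPowerSeriesOnBall f P a 1 := by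
  have hκ : ∀ k, ∀ d : {d : Fin n →₀ ℕ // d.degree = k}, ∃ κ : Fin k → Fin n,
      ∀ y : Fin n → K, ∏ i, y (κ i) = d.1.prod fun j c => y j ^ c :=
    fun k d => exists_prod_coord_eq k d.1 d.2
  choose κ hκ using hκ
  have hfin : ∀ k, Finite {d : Fin n →₀ ℕ // d.degree = k} := fun k =>
    (Finsupp.finite_of_degree_eq k).to_subtype
  have hft : ∀ k, Fintype {d : Fin n →₀ ℕ // d.degree = k} := fun k => Fintype.ofFinite _
  -- Each monomial of degree k becomes a product of k coordinate forms. By the ultrametric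
  -- inequality `P k` has norm at most 1, so the radius is at least 1.
  let P : FormalMultilinearSeries K (Fin n → K) K := fun k =>
    ∑ d : {d : Fin n →₀ ℕ // d.degree = k}, ((MvPowerSeries.coeff d.1 φ : unitBall K) : K) •
      (ContinuousMultilinearMap.mkPiAlgebra K (Fin k) K).compContinuousLinearMap
        fun i => ContinuousLinearMap.proj (κ k d i)
  have hPapp : ∀ k (v : Fin k → Fin n → K), P k v =
      ∑ d : {d : Fin n →₀ ℕ // d.degree = k}, ((MvPowerSeries.coeff d.1 φ : unitBall K) : K) *
        ∏ i, v i (κ k d i) := fun k v => by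
    simp [P, sum_apply]
  refine ⟨P, ?_, one_pos, ?_⟩
  · have hP : ∀ k, ‖P k‖ ≤ 1 := fun k => by
      refine ContinuousMultilinearMap.opNorm_le_bound zero_le_one fun v => ?_
      rw [hPapp, one_mul]
      refine IsUltrametricDist.norm_sum_le_of_forall_le_of_nonneg
        (Finset.prod_nonneg fun _ _ => norm_nonneg _) fun d _ => ?_
      rw [norm_mul, norm_prod]
      refine (mul_le_of_le_one_left (Finset.prod_nonneg fun _ _ => norm_nonneg _)
        (unitBall_norm_le _)).trans ?_
      exact Finset.prod_le_prod (fun _ _ => norm_nonneg _) fun i _ => norm_le_pi_norm (v i) _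
    exact_mod_cast P.le_radius_of_bound 1 (r := 1) fun k => by simpa using hP k
  · intro y hy
    have hy1 : ‖y‖ < 1 := by
      simpa [Metric.mem_eball, edist_zero_right, ← ofReal_norm] using hy
    have hyj : ∀ j, ‖y j‖ < 1 := fun j => (norm_le_pi_norm y j).trans_lt hy1
    let y' : Fin n → unitBall K := fun j => ⟨y j, (hyj j).le⟩
    have hsum := MvPowerSeries.hasSum_aeval (hasEval_of_norm_lt_one (y := y') hyj) φ
    have hsum' := hsum.map (unitBall K).subtype.toAddMonoidHom continuous_subtype_val
    have hfa := h y' hyj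
    have : (fun j => (y' j : K)) = y := rfl
    rw [this] at hfa
    rw [hfa]
    have hsum2 := ((Equiv.sigmaFiberEquiv
      (fun d : Fin n →₀ ℕ => d.degree)).hasSum_iff (f := _)).2 hsum'
    refine hsum2.sigma (g := fun k => P k fun _ => y) fun k => ?_
    have : (P k fun _ => y) = ∑ d : {d : Fin n →₀ ℕ // d.degree = k},
        ((MvPowerSeries.coeff d.1 φ : unitBall K) : K) * d.1.prod fun j c => y j ^ c := by
      rw [hPapp]
      exact Finset.sum_congr rfl fun d _ => by rw [hκ k d y]
    rw [this]
    convert hasSum_fintype _ using 3 with d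
    simp [Finsupp.prod, y']

end UnitBall

/-! ### Normalized coefficient vectors under ring homomorphisms. -/

section RowSolution

variable {R S : Type*} [CommRing R] [CommRing S]

/-- The coefficient vector of `E` in the basis of rows of `coeffMatrix`. -/
def rowSol (F : R[X]) (P g s : ℕ) (E : R[X]) : Fin g → R :=
  Matrix.vecMul (coeffVec F P g s E) (coeffMatrix F P g s)⁻¹

theorem coeffVec_map (φ : R →+* S) (F E : R[X]) (P g s : ℕ) (v : Fin g) :
    coeffVec (F.map φ) P g s (E.map φ) v = φ (coeffVec F P g s E v) := by
  have : (powTower F P s).map φ = powTower (F.map φ) P s := by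
    simp [powTower, Polynomial.map_prod, Polynomial.map_pow]
  rw [coeffVec, coeffVec, ← coeff_map, Polynomial.map_mul, this]

theorem rowSol_map (φ : R →+* S) (F E : R[X]) {P g s : ℕ}
    (hA : IsUnit (coeffMatrix F P g s).det) (v : Fin g) :
    φ (rowSol F P g s E v) = rowSol (F.map φ) P g s (E.map φ) v := by
  have h1 : Matrix.vecMul (rowSol F P g s E) (coeffMatrix F P g s) = coeffVec F P g s E := by
    rw [rowSol, Matrix.vecMul_vecMul, Matrix.nonsing_inv_mul _ hA, Matrix.vecMul_one]
  have h2 : Matrix.vecMul (φ ∘ rowSol F P g s E) (coeffMatrix (F.map φ) P g s) =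
      coeffVec (F.map φ) P g s (E.map φ) := by
    ext w
    rw [← coeffMatrix_map, ← RingHom.map_vecMul, h1, coeffVec_map]
  have hA' : IsUnit (coeffMatrix (F.map φ) P g s).det := by
    rw [← coeffMatrix_map, ← RingHom.mapMatrix_apply, ← RingHom.map_det]
    exact hA.map φ
  have h3 := congrFun (congrArg (fun x => Matrix.vecMul x (coeffMatrix (F.map φ) P g s)⁻¹) h2) v
  rw [Matrix.vecMul_vecMul, Matrix.mul_nonsing_inv _ hA', Matrix.vecMul_one] at h3
  exact h3

theorem rowSol_succ_congr {p e g : ℕ} (hp : p.Prime) (he : 0 < e)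
    (hreg : ∀ x : R, (p : R) * x = 0 → x = 0) (hjac : ∀ x : R, IsUnit (1 + (p : R) * x))
    {F E : R[X]} (hF : F.natDegree ≤ (g + 1) * (p ^ e - 1)) (hE0 : E.coeff 0 = 0)
    (hE : E.natDegree < (g + 1) * p ^ e) (hA : IsUnit (coeffMatrix F (p ^ e) g 1).det)
    {α : ℕ → ℤ} (hα : ∀ s, 1 ≤ s → (p : ℤ) ^ s ∣ α (s + 1) - α s) {s : ℕ} (hs : 1 ≤ s)
    (v : Fin g) : ∃ y : R, (α (s + 1) : R) * rowSol F (p ^ e) g (s + 1) E v =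
      (α s : R) * rowSol F (p ^ e) g s E v + (p : R) ^ s * y := by
  obtain ⟨y, hy⟩ := coeffVec_succ_congr hp he hreg hF
    (isUnit_det_coeffMatrix hp hjac hF hA) hs E hE0 hE
  obtain ⟨c, hc⟩ := hα s hs
  have hc' : (α (s + 1) : R) = α s + (p : R) ^ s * c := by
    rw [sub_eq_iff_eq_add'] at hc
    rw [hc]
    push_cast
    ring
  have hy' : rowSol F (p ^ e) g (s + 1) E v = rowSol F (p ^ e) g s E v + (p : R) ^ s * y v := by
    simpa [rowSol] using congrFun hy v
  exact ⟨α s * y v + c * rowSol F (p ^ e) g (s + 1) E v, by rw [hc']; rw [hy']; ring⟩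

end RowSolution

/-! ### p-adic limits in the valuation ring and in its power series ring. -/

section Limit

theorem eq_of_forall_congr {K : Type} [NontriviallyNormedField K] {p : ℕ} (hp1 : ‖(p : K)‖ < 1) {x y : K}
    (h : ∀ s, 1 ≤ s → ‖x - y‖ ≤ ‖(p : K)‖ ^ s) : x = y := by
  rw [← sub_eq_zero, ← norm_le_zero_iff]
  exact ge_of_tendsto (tendsto_pow_atTop_nhds_zero_of_lt_one (norm_nonneg (p : K)) hp1)
    ((Filter.eventually_ge_atTop 1).mono h)

variable {K : Type} [NontriviallyNormedField K] [IsUltrametricDist K] {p : ℕ}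

theorem isUnit_one_add_unitBall (hp1 : ‖(p : K)‖ < 1) (x : unitBall K) :
    IsUnit (1 + (p : unitBall K) * x) := by
  rw [isUnit_unitBall_iff]
  have h1 : ‖(((p : unitBall K) * x : unitBall K) : K)‖ < 1 :=
    (unitBall_norm_mul_le _ x).trans_lt (by simpa using hp1)
  rw [Subring.coe_add, Subring.coe_one]
  rw [IsUltrametricDist.norm_add_eq_max_of_norm_ne_norm]
  · rw [norm_one, max_eq_left h1.le]
  · rw [norm_one]; exact h1.ne'

theorem unitBall_natCast_mul_eq_zero (hp0 : (p : K) ≠ 0) (x : unitBall K)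
    (h : (p : unitBall K) * x = 0) : x = 0 := by
  have := congrArg Subtype.val h
  simp only [Subring.coe_mul, Subring.coe_natCast, ZeroMemClass.coe_zero, mul_eq_zero, hp0,
    false_or] at this
  exact_mod_cast this

theorem isUnit_one_add_mvPowerSeries (hp1 : ‖(p : K)‖ < 1) {n : ℕ}
    (x : MvPowerSeries (Fin n) (unitBall K)) :
    IsUnit (1 + (p : MvPowerSeries (Fin n) (unitBall K)) * x) := by
  rw [MvPowerSeries.isUnit_iff_constantCoeff]
  simpa using isUnit_one_add_unitBall hp1 (MvPowerSeries.constantCoeff x)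

theorem coeff_natCast_pow_mul {n : ℕ} {O : Type*} [CommRing O] (s : ℕ)
    (x : MvPowerSeries (Fin n) O) (d : Fin n →₀ ℕ) :
    MvPowerSeries.coeff d ((p : MvPowerSeries (Fin n) O) ^ s * x) =
      (p : O) ^ s * MvPowerSeries.coeff d x := by
  have : (p : MvPowerSeries (Fin n) O) ^ s = MvPowerSeries.C ((p : O) ^ s) := by simp
  rw [this, MvPowerSeries.coeff_C_mul]

theorem mvPowerSeries_natCast_mul_eq_zero (hp0 : (p : K) ≠ 0) {n : ℕ}
    (x : MvPowerSeries (Fin n) (unitBall K))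
    (h : (p : MvPowerSeries (Fin n) (unitBall K)) * x = 0) : x = 0 := by
  ext d
  have := coeff_natCast_pow_mul (p := p) 1 x d
  rw [pow_one, h, pow_one] at this
  rw [unitBall_natCast_mul_eq_zero hp0 _ (this.symm.trans (by simp))]
  simp

variable [CompleteSpace K]

/-- The ring of integers is `p`-adically complete. -/
theorem exists_unitBall_limit (hp0 : (p : K) ≠ 0) (hp1 : ‖(p : K)‖ < 1) (x : ℕ → unitBall K)
    (hx : ∀ s, 1 ≤ s → ∃ y, x (s + 1) = x s + (p : unitBall K) ^ s * y) :
    ∃ z, ∀ s, 1 ≤ s → ∃ y, z = x s + (p : unitBall K) ^ s * y := by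
  have hle : ∀ s, 1 ≤ s → ∀ t, s ≤ t → ∃ y, x t = x s + (p : unitBall K) ^ s * y := by
    intro s hs t hst
    induction t, hst using Nat.le_induction with
    | base => exact ⟨0, by simp⟩
    | succ t hst ih =>
      obtain ⟨y, hy⟩ := ih
      obtain ⟨w, hw⟩ := hx t (hs.trans hst)
      obtain ⟨d, rfl⟩ := Nat.exists_eq_add_of_le hst
      exact ⟨y + (p : unitBall K) ^ d * w, by rw [hw, hy]; ring⟩
  have hdist : ∀ s, 1 ≤ s → ∀ t, s ≤ t → dist (x t) (x s) ≤ ‖(p : K)‖ ^ s := by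
    intro s hs t hst
    obtain ⟨y, hy⟩ := hle s hs t hst
    rw [hy, dist_eq_norm, add_sub_cancel_left]
    exact (unitBall_norm_mul_le _ y).trans (by simp)
  have hpow := tendsto_pow_atTop_nhds_zero_of_lt_one (norm_nonneg (p : K)) hp1
  have hcau : CauchySeq x := by
    rw [Metric.cauchySeq_iff']
    intro ε hε
    obtain ⟨N, hN⟩ := ((hpow.eventually (gt_mem_nhds hε)).and
      (Filter.eventually_ge_atTop 1)).exists
    exact ⟨N, fun t ht => (hdist N hN.2 t ht).trans_lt hN.1⟩
  obtain ⟨z, hz⟩ := cauchySeq_tendsto_of_complete hcau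
  refine ⟨z, fun s hs => ?_⟩
  have h1 : dist z (x s) ≤ ‖(p : K)‖ ^ s :=
    le_of_tendsto (hz.dist tendsto_const_nhds)
      ((Filter.eventually_ge_atTop s).mono fun t ht => hdist s hs t ht)
  obtain ⟨y, hy⟩ := unitBall_dvd (c := (p : unitBall K) ^ s) (x := z - x s)
    (by simpa using pow_ne_zero s hp0) (by simpa [dist_eq_norm] using h1)
  exact ⟨y, by rw [← hy]; ring⟩

theorem exists_mvPowerSeries_limit (hp0 : (p : K) ≠ 0) (hp1 : ‖(p : K)‖ < 1) {n : ℕ}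
    (x : ℕ → MvPowerSeries (Fin n) (unitBall K))
    (hx : ∀ s, 1 ≤ s → ∃ y, x (s + 1) = x s + (p : MvPowerSeries (Fin n) (unitBall K)) ^ s * y) :
    ∃ z, ∀ s, 1 ≤ s → ∃ y, z = x s + (p : MvPowerSeries (Fin n) (unitBall K)) ^ s * y := by
  have h1 : ∀ d : Fin n →₀ ℕ, ∃ z, ∀ s, 1 ≤ s → ∃ y,
      z = MvPowerSeries.coeff d (x s) + (p : unitBall K) ^ s * y := fun d =>
    exists_unitBall_limit hp0 hp1 _ fun s hs => by
      obtain ⟨y, hy⟩ := hx s hs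
      exact ⟨MvPowerSeries.coeff d y, by rw [hy, map_add, coeff_natCast_pow_mul]⟩
  choose z hz using h1
  let Z : MvPowerSeries (Fin n) (unitBall K) := z
  refine ⟨Z, fun s hs => ?_⟩
  choose y hy using fun d => hz d s hs
  let Y : MvPowerSeries (Fin n) (unitBall K) := y
  refine ⟨Y, MvPowerSeries.ext fun d => ?_⟩
  rw [map_add, coeff_natCast_pow_mul]
  exact hy d

end Limit

/-! ### Uniform convergence to analytic functions. -/

section Main

variable {n : ℕ}

/-- Evaluation of integral polynomials at a point. -/
def evHom {R : Type*} [CommRing R] (a : Fin n → R) : MvPolynomial (Fin n) ℤ →+* R :=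
  (MvPolynomial.aeval a : MvPolynomial (Fin n) ℤ →ₐ[ℤ] R).toRingHom

theorem comp_evHom {R S : Type*} [CommRing R] [CommRing S] (ψ : R →+* S) (a : Fin n → R) :
    ψ.comp (evHom a) = evHom fun j => ψ (a j) :=
  MvPolynomial.ringHom_ext (fun r => by simp [evHom]) fun j => by simp [evHom]

theorem evHom_evHom {R S : Type*} [CommRing R] [CommRing S] (ψ : R →+* S) (a : Fin n → R)
    (f : MvPolynomial (Fin n) ℤ) : ψ (evHom a f) = evHom (fun j => ψ (a j)) f := by
  rw [← comp_evHom, RingHom.comp_apply]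

/-- The points with integral coordinates where `det A_1` is a unit. -/
def goodPoints (K : Type) [NontriviallyNormedField K] (F : (MvPolynomial (Fin n) ℤ)[X])
    (P g : ℕ) : Set (Fin n → K) :=
  {a | (∀ j, ‖a j‖ ≤ 1) ∧ ‖(matEval (coeffMatrix F P g 1) a).det‖ = 1}

theorem det_coeffMatrix_map {R : Type*} [CommRing R] (φ : MvPolynomial (Fin n) ℤ →+* R)
    (F : (MvPolynomial (Fin n) ℤ)[X]) (P g s : ℕ) :
    (coeffMatrix (F.map φ) P g s).det = φ (coeffMatrix F P g s).det := by
  rw [← coeffMatrix_map, RingHom.map_det, RingHom.mapMatrix_apply]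

theorem matEval_det {K : Type} [Field K] {g : ℕ}
    (M : Matrix (Fin g) (Fin g) (MvPolynomial (Fin n) ℤ)) (a : Fin n → K) :
    (matEval M a).det = evHom a M.det := by
  rw [RingHom.map_det, RingHom.mapMatrix_apply]; rfl

/-- The sequence whose limit is taken. -/
def rowSeq {R : Type*} [CommRing R] (F E : (MvPolynomial (Fin n) ℤ)[X]) (P g : ℕ) (α : ℕ → ℤ)
    (s : ℕ) (a : Fin n → R) (v : Fin g) : R :=
  (α s : R) * rowSol (F.map (evHom a)) P g s (E.map (evHom a)) v

theorem rowSeq_map {R S : Type*} [CommRing R] [CommRing S] (ψ : R →+* S)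
    (F E : (MvPolynomial (Fin n) ℤ)[X]) {P g : ℕ} (α : ℕ → ℤ) {s : ℕ} {a : Fin n → R}
    (hA : IsUnit (coeffMatrix (F.map (evHom a)) P g s).det) (v : Fin g) :
    ψ (rowSeq F E P g α s a v) = rowSeq F E P g α s (fun j => ψ (a j)) v := by
  rw [rowSeq, map_mul, rowSol_map ψ _ _ hA, Polynomial.map_map, Polynomial.map_map, comp_evHom]
  simp [rowSeq]

variable {K : Type} [NontriviallyNormedField K] [IsUltrametricDist K]

theorem isUnit_det_iff {F : (MvPolynomial (Fin n) ℤ)[X]} {P g s : ℕ} {a : Fin n → unitBall K} :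
    IsUnit (coeffMatrix (F.map (evHom a)) P g s).det ↔
      ‖(matEval (coeffMatrix F P g s) fun j => (a j : K)).det‖ = 1 := by
  rw [isUnit_unitBall_iff, det_coeffMatrix_map, matEval_det]
  exact Iff.of_eq (congrArg (fun x => ‖x‖ = 1) (evHom_evHom (unitBall K).subtype a _))

theorem mem_goodPoints_iff {F : (MvPolynomial (Fin n) ℤ)[X]} {P g : ℕ} {a : Fin n → unitBall K} :
    (fun j => (a j : K)) ∈ goodPoints K F P g ↔
      IsUnit (coeffMatrix (F.map (evHom a)) P g 1).det := by
  rw [isUnit_det_iff]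
  exact ⟨fun h => h.2, fun h => ⟨fun j => (a j).2, h⟩⟩

theorem norm_det_eq_one_of_mem_goodPoints {p e g : ℕ} (hp : p.Prime) (hp1 : ‖(p : K)‖ < 1)
    {F : (MvPolynomial (Fin n) ℤ)[X]} (hF : F.natDegree ≤ (g + 1) * (p ^ e - 1))
    {a : Fin n → K} (ha : a ∈ goodPoints K F (p ^ e) g) {s : ℕ} (hs : 1 ≤ s) :
    ‖(matEval (coeffMatrix F (p ^ e) g s) a).det‖ = 1 := by
  lift a to Fin n → unitBall K using ha.1
  rw [← isUnit_det_iff]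
  exact isUnit_det_coeffMatrix hp (isUnit_one_add_unitBall hp1) (natDegree_map_le.trans hF)
    (mem_goodPoints_iff.1 ha) s hs

theorem rowSeq_congr {R : Type*} [CommRing R] {p e g : ℕ} (hp : p.Prime) (he : 0 < e)
    (hreg : ∀ x : R, (p : R) * x = 0 → x = 0) (hjac : ∀ x : R, IsUnit (1 + (p : R) * x))
    {F E : (MvPolynomial (Fin n) ℤ)[X]}
    (hF : F.natDegree ≤ (g + 1) * (p ^ e - 1)) (hE0 : E.coeff 0 = 0)
    (hE : E.natDegree < (g + 1) * p ^ e)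
    {α : ℕ → ℤ} (hα : ∀ s, 1 ≤ s → (p : ℤ) ^ s ∣ α (s + 1) - α s) {a : Fin n → R}
    (hA : IsUnit (coeffMatrix (F.map (evHom a)) (p ^ e) g 1).det) {s : ℕ} (hs : 1 ≤ s)
    (v : Fin g) : ∃ y : R, rowSeq F E (p ^ e) g α (s + 1) a v =
      rowSeq F E (p ^ e) g α s a v + (p : R) ^ s * y :=
  rowSol_succ_congr hp he hreg hjac (natDegree_map_le.trans hF) (by simp [hE0])
    (natDegree_map_le.trans_lt hE) hA hα hs v

/-- The rows converge uniformly on the domain to analytic functions. -/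
theorem exists_analytic_limit [CompleteSpace K] {p e g : ℕ} (hp : p.Prime) (he : 0 < e)
    (hp0 : (p : K) ≠ 0) (hp1 : ‖(p : K)‖ < 1) {F E : (MvPolynomial (Fin n) ℤ)[X]}
    (hF : F.natDegree ≤ (g + 1) * (p ^ e - 1)) (hE0 : E.coeff 0 = 0)
    (hE : E.natDegree < (g + 1) * p ^ e)
    {α : ℕ → ℤ} (hα : ∀ s, 1 ≤ s → (p : ℤ) ^ s ∣ α (s + 1) - α s) (v : Fin g) :
    ∃ f : (Fin n → K) → K,
      (∀ s, 1 ≤ s → ∀ a ∈ goodPoints K F (p ^ e) g,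
        ‖f a - rowSeq F E (p ^ e) g α s a v‖ ≤ ‖(p : K)‖ ^ s) ∧
      ∀ a ∈ goodPoints K F (p ^ e) g,
        ∃ P : FormalMultilinearSeries K (Fin n → K) K, HasFPowerSeriesOnBall f P a 1 := by
  have hlim : ∀ a ∈ goodPoints K F (p ^ e) g, ∃ z : K, ∀ s, 1 ≤ s →
      ‖z - rowSeq F E (p ^ e) g α s a v‖ ≤ ‖(p : K)‖ ^ s := by
    intro a ha
    lift a to Fin n → unitBall K using ha.1
    have hA := mem_goodPoints_iff.1 ha
    obtain ⟨z, hz⟩ := exists_unitBall_limit hp0 hp1 (fun s => rowSeq F E (p ^ e) g α s a v)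
      fun s hs => rowSeq_congr hp he (unitBall_natCast_mul_eq_zero hp0)
        (isUnit_one_add_unitBall hp1) hF hE0 hE hα hA hs v
    refine ⟨z, fun s hs => ?_⟩
    obtain ⟨y, hy⟩ := hz s hs
    have h1 := rowSeq_map (unitBall K).subtype F E α (isUnit_det_coeffMatrix hp
      (isUnit_one_add_unitBall hp1) (natDegree_map_le.trans hF) hA s hs) v
    have h2 : (z : K) - rowSeq F E (p ^ e) g α s (fun j => (a j : K)) v =
        (((p : unitBall K) ^ s * y : unitBall K) : K) := by
      rw [hy]
      push_cast
      rw [sub_eq_iff_eq_add']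
      congr 1
    rw [h2]
    exact (unitBall_norm_mul_le _ y).trans (by simp)
  choose! f hf using hlim
  refine ⟨f, fun s hs a ha => hf a ha s hs, fun a ha => ?_⟩
  lift a to Fin n → unitBall K using ha.1
  have hA := mem_goodPoints_iff.1 ha
  -- The generic point a + z of the polydisc around a; its determinant is a unit since its constant
  -- term is the determinant at a.
  let b : Fin n → MvPowerSeries (Fin n) (unitBall K) := fun j =>
    MvPowerSeries.C (a j) + MvPowerSeries.X j
  have hB : IsUnit (coeffMatrix (F.map (evHom b)) (p ^ e) g 1).det := by
    rw [MvPowerSeries.isUnit_iff_constantCoeff, det_coeffMatrix_map, evHom_evHom,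
      ← det_coeffMatrix_map]
    simpa [b] using hA
  have hBs := isUnit_det_coeffMatrix hp (isUnit_one_add_mvPowerSeries hp1)
    (natDegree_map_le.trans hF) hB
  obtain ⟨φ, hφ⟩ := exists_mvPowerSeries_limit hp0 hp1
    (fun s => rowSeq F E (p ^ e) g α s b v)
    fun s hs => rowSeq_congr hp he (mvPowerSeries_natCast_mul_eq_zero hp0)
      (isUnit_one_add_mvPowerSeries hp1) hF hE0 hE hα hB hs v
  refine hasFPowerSeriesOnBall_of_aeval φ f _ fun y hy => ?_
  set ψ := MvPowerSeries.aeval (hasEval_of_norm_lt_one hy) (R := unitBall K) with hψ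
  have hψb : (fun j => ψ.toRingHom (b j)) = a + y := by
    funext j
    have h1 : ψ (MvPowerSeries.X j) = y j := by
      rw [← MvPolynomial.coe_X, hψ, MvPowerSeries.aeval_coe, MvPolynomial.aeval_X]
    have h2 : ψ (MvPowerSeries.C (a j)) = a j := ψ.commutes (a j)
    exact (map_add ψ _ _).trans (by rw [h1, h2]; rfl)
  -- The determinant at a + y is the image under ψ of the unit determinant at the generic point.
  have hmem : (fun j => ((a + y) j : K)) ∈ goodPoints K F (p ^ e) g := by
    rw [mem_goodPoints_iff, ← hψb, det_coeffMatrix_map, ← evHom_evHom, ← det_coeffMatrix_map]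
    exact hB.map ψ.toRingHom
  have hay : ((fun j => (a j : K)) + fun j => (y j : K)) = fun j => ((a + y) j : K) := by
    ext j; simp
  rw [hay]
  refine eq_of_forall_congr hp1 fun s hs => ?_
  obtain ⟨r, hr⟩ := hφ s hs
  have h1 : rowSeq F E (p ^ e) g α s (fun j => ((a + y) j : K)) v =
      (ψ (rowSeq F E (p ^ e) g α s b v) : K) := by
    have h2 := rowSeq_map ((unitBall K).subtype.comp ψ.toRingHom) F E α (hBs s hs) v
    simp only [RingHom.comp_apply] at h2
    have h3 := congrArg (fun c : Fin n → unitBall K => fun j => (c j : K)) hψb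
    refine Eq.trans ?_ h2.symm
    exact congrArg (fun c => rowSeq F E (p ^ e) g α s c v) h3.symm
  -- Both f(a + y) and ψ(φ) are within |p|^s of the same s-th term.
  have h4 : f (fun j => ((a + y) j : K)) - (ψ φ : K) =
      (f (fun j => ((a + y) j : K)) - rowSeq F E (p ^ e) g α s (fun j => ((a + y) j : K)) v) +
        -(((p : unitBall K) ^ s * ψ r : unitBall K) : K) := by
    rw [h1, hr]
    simp
    ring
  rw [h4]
  refine (IsUltrametricDist.norm_add_le_max _ _).trans (max_le (hf _ hmem s hs) ?_)
  rw [norm_neg]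
  exact (unitBall_norm_mul_le _ _).trans (by simp)

end Main

/-! ### Derivatives in z_i of products of the linear factors t - z_j. -/

section CoeffDeriv

variable {n : ℕ}

/-- `f'` is the coefficientwise derivative of `f` with respect to `z_i`. -/
def HasCoeffPDeriv (i : Fin n) (f f' : (MvPolynomial (Fin n) ℤ)[X]) : Prop :=
  ∀ k, MvPolynomial.pderiv i (f.coeff k) = f'.coeff k

theorem HasCoeffPDeriv.mul {i : Fin n} {f f' h h' : (MvPolynomial (Fin n) ℤ)[X]}
    (hf : HasCoeffPDeriv i f f') (hh : HasCoeffPDeriv i h h') :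
    HasCoeffPDeriv i (f * h) (f' * h + f * h') := fun k => by
  rw [coeff_add, coeff_mul, coeff_mul, coeff_mul, map_sum, ← Finset.sum_add_distrib]
  refine Finset.sum_congr rfl fun x _ => ?_
  rw [Derivation.leibniz, hf, hh]
  simp only [smul_eq_mul]
  ring

theorem HasCoeffPDeriv.one (i : Fin n) : HasCoeffPDeriv i 1 0 := fun k => by
  rw [coeff_one]; split_ifs <;> simp

theorem HasCoeffPDeriv.pow {i : Fin n} {f f' : (MvPolynomial (Fin n) ℤ)[X]}
    (hf : HasCoeffPDeriv i f f') (m : ℕ) :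
    HasCoeffPDeriv i (f ^ m) (m * f ^ (m - 1) * f') := by
  induction m with
  | zero => simpa using HasCoeffPDeriv.one i
  | succ m ih =>
    rw [pow_succ]
    convert ih.mul hf using 1
    rcases m with _ | m
    · simp
    · simp only [Nat.add_sub_cancel]; push_cast; ring

theorem HasCoeffPDeriv.prod_of_zero {i : Fin n} {ι : Type*} (s : Finset ι)
    (f : ι → (MvPolynomial (Fin n) ℤ)[X]) (h : ∀ j ∈ s, HasCoeffPDeriv i (f j) 0) :
    HasCoeffPDeriv i (∏ j ∈ s, f j) 0 := by
  classical
  induction s using Finset.induction_on with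
  | empty => simpa using HasCoeffPDeriv.one i
  | insert a s ha ih =>
    rw [Finset.prod_insert ha]
    simpa using (h a (by simp)).mul (ih fun j hj => h j (by simp [hj]))

theorem HasCoeffPDeriv.X_sub_C (i j : Fin n) :
    HasCoeffPDeriv i (X - C (MvPolynomial.X j)) (if i = j then -1 else 0) := fun k => by
  rw [coeff_sub, coeff_X, coeff_C, map_sub]
  rcases eq_or_ne i j with rfl | hij
  · rcases k with _ | k
    · simp
    · simp [coeff_one]; split_ifs <;> simp
  · split_ifs <;> simp [MvPolynomial.pderiv_X, hij.symm]

/-- The product of `t - z_j` over a finite set of indices. -/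
def linProd (T : Finset (Fin n)) : (MvPolynomial (Fin n) ℤ)[X] :=
  ∏ j ∈ T, (X - C (MvPolynomial.X j))

theorem linProd_eq_mul_erase {T : Finset (Fin n)} {i : Fin n} (hi : i ∈ T) :
    linProd T = (X - C (MvPolynomial.X i)) * linProd (T.erase i) :=
  (Finset.mul_prod_erase T _ hi).symm

theorem hasCoeffPDeriv_linProd_of_notMem {T : Finset (Fin n)} {i : Fin n} (hi : i ∉ T) :
    HasCoeffPDeriv i (linProd T) 0 :=
  HasCoeffPDeriv.prod_of_zero T _ fun j hj => by
    simpa [(ne_of_mem_of_not_mem hj hi).symm] using HasCoeffPDeriv.X_sub_C i j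

theorem hasCoeffPDeriv_linProd {T : Finset (Fin n)} {i : Fin n} (hi : i ∈ T) :
    HasCoeffPDeriv i (linProd T) (-linProd (T.erase i)) := by
  rw [linProd_eq_mul_erase hi]
  convert (HasCoeffPDeriv.X_sub_C i i).mul
    (hasCoeffPDeriv_linProd_of_notMem (Finset.notMem_erase i T)) using 1
  rw [if_pos rfl]
  ring

theorem natDegree_linProd_le (T : Finset (Fin n)) : (linProd T).natDegree ≤ n := by
  refine (natDegree_prod_le _ _).trans ((Finset.sum_le_card_nsmul _ _ 1 fun j _ =>
    (natDegree_X_sub_C_le _)).trans ?_)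
  simpa using Finset.card_le_univ T

theorem natDegree_linProd_mul_pow_le (T : Finset (Fin n)) {N : ℕ} (hN : 1 ≤ N) :
    (linProd T * linProd Finset.univ ^ (N - 1)).natDegree ≤ n * N := by
  obtain ⟨k, rfl⟩ := Nat.exists_eq_add_of_le hN
  refine natDegree_mul_le.trans ((add_le_add (natDegree_linProd_le T)
    (natDegree_pow_le.trans (Nat.mul_le_mul_left _ (natDegree_linProd_le _)))).trans ?_)
  rw [Nat.add_sub_cancel_left]
  linarith

theorem natDegree_linProd_mul_linProd_mul_pow_le (T T' : Finset (Fin n)) {N : ℕ} (hN : 2 ≤ N) :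
    (linProd T * linProd T' * linProd Finset.univ ^ (N - 2)).natDegree ≤ n * N := by
  rw [mul_assoc]
  have h1 := natDegree_linProd_mul_pow_le T' (N := N - 1) (by omega)
  rw [Nat.sub_sub] at h1
  refine natDegree_mul_le.trans ((add_le_add (natDegree_linProd_le T) h1).trans ?_)
  obtain ⟨k, rfl⟩ := Nat.exists_eq_add_of_le hN
  rw [show 2 + k - 1 = 1 + k by omega]
  linarith

/-- The derivative of a power of the full product. -/
theorem hasCoeffPDeriv_pow (i : Fin n) (M : ℕ) :
    HasCoeffPDeriv i (linProd (Finset.univ : Finset (Fin n)) ^ M)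
      (-(M : (MvPolynomial (Fin n) ℤ)[X]) *
        (linProd (Finset.univ.erase i) * linProd Finset.univ ^ (M - 1))) := by
  convert (hasCoeffPDeriv_linProd (Finset.mem_univ i)).pow M using 1
  ring

/-- The derivative of the quotient of such a power by `t - z_j`. -/
theorem hasCoeffPDeriv_div (i j : Fin n) {M : ℕ} (hM : 2 ≤ M) :
    HasCoeffPDeriv i (linProd (Finset.univ.erase j) * linProd Finset.univ ^ (M - 1))
      (((-(M : ℤ) + if i = j then 1 else 0 : ℤ) : (MvPolynomial (Fin n) ℤ)[X]) *
        (linProd (Finset.univ.erase i) * linProd (Finset.univ.erase j) *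
          linProd Finset.univ ^ (M - 2))) := by
  obtain ⟨m, rfl⟩ := Nat.exists_eq_add_of_le' hM
  have h1 : m + 2 - 1 = m + 1 := rfl
  have h2 := hasCoeffPDeriv_pow i (m + 1)
  rw [h1]
  -- The factor t - z_i occurs M - 1 times if i = j and M times otherwise, whence the two scalars.
  rcases eq_or_ne i j with rfl | hij
  · convert (hasCoeffPDeriv_linProd_of_notMem (Finset.notMem_erase i Finset.univ)).mul h2 using 1
    simp
    ring
  · have hi : i ∈ Finset.univ.erase j := by simp [hij]
    convert (hasCoeffPDeriv_linProd hi).mul h2 using 1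
    have h3 : linProd (Finset.univ.erase i) = (X - C (MvPolynomial.X j)) *
        linProd ((Finset.univ.erase j).erase i) := by
      rw [Finset.erase_right_comm]
      exact linProd_eq_mul_erase (by simp [hij.symm])
    have h4 : linProd (Finset.univ : Finset (Fin n)) =
      (X - C (MvPolynomial.X j)) * linProd (Finset.univ.erase j) :=
        linProd_eq_mul_erase (Finset.mem_univ j)
    simp only [hij, if_false, Nat.add_sub_cancel]
    rw [pow_succ, h3]
    set Y := linProd (Finset.univ : Finset (Fin n)) ^ m
    rw [h4]
    push_cast
    ring

end CoeffDeriv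

/-! ### The matrices of the theorem as coefficient vectors. -/

section Concrete

variable {n p q e g : ℕ}

theorem masterPoly_eq (n p q e s : ℕ) :
    masterPoly n p q e s = linProd Finset.univ ^ (((p ^ e) ^ s - 1) / q) := by
  rw [masterPoly, linProd, pow_mul]

theorem masterPoly_divByMonic (i : Fin n) {s : ℕ} (hM : 0 < ((p ^ e) ^ s - 1) / q) :
    masterPoly n p q e s /ₘ (X - C (MvPolynomial.X i)) =
      linProd (Finset.univ.erase i) * linProd Finset.univ ^ (((p ^ e) ^ s - 1) / q - 1) := by
  obtain ⟨M, hM'⟩ : ∃ M, ((p ^ e) ^ s - 1) / q = M + 1 := Nat.exists_eq_add_of_le' hM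
  rw [masterPoly_eq, hM', pow_succ, Nat.add_sub_cancel]
  nth_rw 2 [linProd_eq_mul_erase (Finset.mem_univ i)]
  rw [mul_left_comm, mul_divByMonic_cancel_left _ (monic_X_sub_C _), mul_comm]

theorem pow_sub_one_div {P q : ℕ} (hq : 0 < q) (hP : 0 < P) (hqP : q ∣ P - 1) (s : ℕ) :
    (P ^ (s + 1) - 1) / q = (P ^ s - 1) / q + (P - 1) / q * P ^ s := by
  obtain ⟨N, hN⟩ := hqP
  obtain rfl : P = q * N + 1 := by omega
  have h1 : 0 < (q * N + 1) ^ s := pow_pos hP s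
  rw [Nat.add_sub_cancel, Nat.mul_div_cancel_left _ hq, ← Nat.add_mul_div_left _ _ hq]
  congr 1
  rw [pow_succ]
  have : (q * N + 1) ^ s * (q * N + 1) = q * (N * (q * N + 1) ^ s) + (q * N + 1) ^ s := by ring
  omega

theorem exists_powTower_eq {R : Type*} [CommRing R] (Q : R[X]) {P q : ℕ} (hq : 0 < q) (hP : 0 < P)
    (hqP : q ∣ P - 1) {s : ℕ} (hs : 1 ≤ s) :
    ∃ r, powTower (Q ^ ((P - 1) / q)) P s = Q ^ r ∧ (P ^ s - 1) / q = (P - 1) / q + r := by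
  induction s, hs using Nat.le_induction with
  | base => exact ⟨0, by simp⟩
  | succ s hs ih =>
    obtain ⟨r, hr, hr'⟩ := ih
    refine ⟨r + (P - 1) / q * P ^ s, ?_, ?_⟩
    · rw [powTower_succ _ _ hs, hr, ← pow_mul, ← pow_add]
    · rw [pow_sub_one_div hq hP hqP, hr', add_assoc]

/-- The factor `F` of which all master polynomials are built. -/
def baseFactor (n p q e : ℕ) : (MvPolynomial (Fin n) ℤ)[X] :=
  linProd Finset.univ ^ ((p ^ e - 1) / q)

/-- The c factors removed by division or differentiation are taken from the head Q^N, so the tower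
stays intact. -/
theorem pow_eq_mul_powTower (hq : 0 < q) (hp : 0 < p) (hqP : q ∣ p ^ e - 1) {s : ℕ} (hs : 1 ≤ s)
    {c : ℕ} (hc : c ≤ (p ^ e - 1) / q) :
    linProd (Finset.univ : Finset (Fin n)) ^ (((p ^ e) ^ s - 1) / q - c) =
      linProd Finset.univ ^ ((p ^ e - 1) / q - c) * powTower (baseFactor n p q e) (p ^ e) s := by
  obtain ⟨r, hr, hr'⟩ := exists_powTower_eq (linProd (Finset.univ : Finset (Fin n))) hq
    (pow_pos hp e) hqP hs
  rw [baseFactor, hr, hr', ← pow_add, Nat.sub_add_comm hc]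

/-- Multiplication by t^(u+1) shifts the index to a multiple of P^s; g ≤ P keeps the subtraction
from truncating. -/
theorem coeff_sub_eq_coeffVec (hg : g ≤ p ^ e) {s : ℕ} (hs : 1 ≤ s)
    (F H : (MvPolynomial (Fin n) ℤ)[X]) {u : ℕ} (hu : u < g) (v : Fin g) :
    (H * powTower F (p ^ e) s).coeff (p ^ (e * s) * ((v : ℕ) + 1) - (u + 1)) =
      coeffVec F (p ^ e) g s (X ^ (u + 1) * H) v := by
  have h1 : u + 1 ≤ (p ^ e) ^ s * ((v : ℕ) + 1) :=
    calc u + 1 ≤ p ^ e := by omega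
      _ ≤ (p ^ e) ^ s := Nat.le_self_pow (by omega) _
      _ ≤ _ := Nat.le_mul_of_pos_right _ (by omega)
  rw [coeffVec, mul_assoc, pow_mul]
  conv_rhs => rw [← Nat.sub_add_cancel h1]
  rw [coeff_X_pow_mul]

theorem hasseWitt_eq (hq : 0 < q) (hp : 0 < p) (hg : g ≤ p ^ e) (hqP : q ∣ p ^ e - 1)
    {s : ℕ} (hs : 1 ≤ s) :
    hasseWitt n g p q e s = coeffMatrix (baseFactor n p q e) (p ^ e) g s := by
  ext1 u v
  have h := pow_eq_mul_powTower (n := n) hq hp hqP hs (c := 0) (Nat.zero_le _)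
  simp only [Nat.sub_zero] at h
  rw [hasseWitt, Matrix.of_apply, masterPoly_eq, h, coeff_sub_eq_coeffVec hg hs _ _ u.2]
  rfl

theorem solMatrix_eq (hq : 0 < q) (hp : 0 < p) (hg : g ≤ p ^ e) (hqP : q ∣ p ^ e - 1)
    (hN : 2 ≤ (p ^ e - 1) / q) {s : ℕ} (hs : 1 ≤ s) (j : Fin n) (v : Fin g) :
    solMatrix n g p q e s j v = coeffVec (baseFactor n p q e) (p ^ e) g s
      (X ^ (0 + 1) * (linProd (Finset.univ.erase j) *
        linProd Finset.univ ^ ((p ^ e - 1) / q - 1))) v := by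
  have h := pow_eq_mul_powTower (n := n) hq hp hqP hs (c := 1) (by omega)
  -- Only the numerical identity is kept: the exponent of Φ_s is at least N, hence positive.
  obtain ⟨r, -, hr⟩ := exists_powTower_eq (1 : ℤ[X]) hq (pow_pos hp e) hqP hs
  rw [← coeff_sub_eq_coeffVec hg hs _ _ (Fin.pos v), mul_assoc, ← h, solMatrix,
    Matrix.of_apply, masterPoly_divByMonic j (by omega), mul_comm (p ^ (e * s))]

theorem matPDeriv_hasseWitt_eq (hq : 0 < q) (hp : 0 < p) (hg : g ≤ p ^ e) (hqP : q ∣ p ^ e - 1)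
    (hN : 2 ≤ (p ^ e - 1) / q) {s : ℕ} (hs : 1 ≤ s) (i : Fin n) (u v : Fin g) :
    matPDeriv i (hasseWitt n g p q e s) u v =
      ((-(((p ^ e) ^ s - 1) / q : ℕ) : ℤ) : MvPolynomial (Fin n) ℤ) *
      coeffVec (baseFactor n p q e) (p ^ e) g s
      (X ^ ((u : ℕ) + 1) * (linProd (Finset.univ.erase i) *
        linProd Finset.univ ^ ((p ^ e - 1) / q - 1))) v := by
  have h := pow_eq_mul_powTower (n := n) hq hp hqP hs (c := 1) (by omega)
  rw [← coeff_sub_eq_coeffVec hg hs _ _ u.2, mul_assoc, ← h, matPDeriv, Matrix.map_apply,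
    hasseWitt, Matrix.of_apply, masterPoly_eq, hasCoeffPDeriv_pow, ← coeff_C_mul]
  generalize ((p ^ e) ^ s - 1) / q = M
  simp

theorem matPDeriv_solMatrix_eq (hq : 0 < q) (hp : 0 < p) (hg : g ≤ p ^ e) (hqP : q ∣ p ^ e - 1)
    (hN : 2 ≤ (p ^ e - 1) / q) {s : ℕ} (hs : 1 ≤ s) (i j : Fin n) (v : Fin g) :
    matPDeriv i (solMatrix n g p q e s) j v =
      ((-(((p ^ e) ^ s - 1) / q : ℕ) + if i = j then 1 else 0 : ℤ) : MvPolynomial (Fin n) ℤ) *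
      coeffVec (baseFactor n p q e) (p ^ e) g s
      (X ^ (0 + 1) * (linProd (Finset.univ.erase i) * linProd (Finset.univ.erase j) *
        linProd Finset.univ ^ ((p ^ e - 1) / q - 2))) v := by
  have h := pow_eq_mul_powTower (n := n) hq hp hqP hs (c := 2) (by omega)
  obtain ⟨r, -, hr⟩ := exists_powTower_eq (1 : ℤ[X]) hq (pow_pos hp e) hqP hs
  rw [← coeff_sub_eq_coeffVec hg hs _ _ (Fin.pos v), mul_assoc, ← h, matPDeriv,
    Matrix.map_apply, solMatrix, Matrix.of_apply, masterPoly_divByMonic j (by omega),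
    hasCoeffPDeriv_div i j (by omega), ← coeff_C_mul, mul_comm (p ^ (e * s))]
  simp

/-- The degree is at most (gq + 1)N = g(P - 1) + N, and N ≤ P - 1. -/
theorem natDegree_baseFactor_le (hqP : q ∣ p ^ e - 1) (hq : 0 < q) :
    (baseFactor (g * q + 1) p q e).natDegree ≤ (g + 1) * (p ^ e - 1) := by
  refine natDegree_pow_le.trans ((Nat.mul_le_mul_left _ (natDegree_linProd_le _)).trans ?_)
  obtain ⟨N, hN⟩ := hqP
  rw [hN, Nat.mul_div_cancel_left _ hq]
  nlinarith [Nat.le_mul_of_pos_left N hq]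

theorem natDegree_row_lt (hp : 0 < p) (hqP : q ∣ p ^ e - 1) (hq : 0 < q) {u : ℕ} (hu : u < g)
    {H : (MvPolynomial (Fin (g * q + 1)) ℤ)[X]}
    (hH : H.natDegree ≤ (g * q + 1) * ((p ^ e - 1) / q)) :
    (X ^ (u + 1) * H).natDegree < (g + 1) * p ^ e := by
  refine natDegree_mul_le.trans_lt ?_
  have h1 := natDegree_X_pow_le (R := MvPolynomial (Fin (g * q + 1)) ℤ) (u + 1)
  have h2 : 0 < p ^ e := pow_pos hp e
  obtain ⟨N, hN⟩ := hqP
  rw [hN, Nat.mul_div_cancel_left _ hq] at hH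
  obtain hP : p ^ e = q * N + 1 := by omega
  rw [hP]
  nlinarith [Nat.le_mul_of_pos_left N hq]

end Concrete

/-! ### First order expansion of I A⁻¹ with integral remainder. -/

section Taylor

variable {n : ℕ} {R : Type*} [CommRing R]

/-- First order Taylor expansion in the direction of a coordinate. -/
theorem exists_evHom_update (a : Fin n → R) (i : Fin n) (t : R) (f : MvPolynomial (Fin n) ℤ) :
    ∃ r, evHom (Function.update a i (a i + t)) f =
      evHom a f + t * evHom a (MvPolynomial.pderiv i f) + t ^ 2 * r := by
  induction f using MvPolynomial.induction_on with
  | C c => exact ⟨0, by simp [evHom]⟩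
  | add f h hf hh =>
    obtain ⟨r, hr⟩ := hf
    obtain ⟨r', hr'⟩ := hh
    exact ⟨r + r', by simp only [map_add, hr, hr']; ring⟩
  | mul_X f j hf =>
    obtain ⟨r, hr⟩ := hf
    have hX : ∀ b : Fin n → R, evHom b (MvPolynomial.X j) = b j := fun b => by simp [evHom]
    rcases eq_or_ne j i with rfl | hj
    · refine ⟨evHom a (MvPolynomial.pderiv j f) + r * (a j + t), ?_⟩
      simp only [map_mul, map_add, Derivation.leibniz, hr, hX, Function.update_self,
        MvPolynomial.pderiv_X_self, smul_eq_mul, mul_one]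
      ring
    · refine ⟨r * a j, ?_⟩
      simp only [map_mul, map_add, Derivation.leibniz, hr, hX, Function.update_of_ne hj,
        MvPolynomial.pderiv_X_of_ne hj, smul_eq_mul, mul_zero, map_zero]
      ring

theorem exists_map_evHom_update {ι κ : Type} (a : Fin n → R) (i : Fin n) (t : R)
    (M : Matrix ι κ (MvPolynomial (Fin n) ℤ)) :
    ∃ W : Matrix ι κ R, M.map (evHom (Function.update a i (a i + t))) =
      M.map (evHom a) + t • (matPDeriv i M).map (evHom a) + t ^ 2 • W := by
  choose r hr using fun k l => exists_evHom_update a i t (M k l)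
  exact ⟨Matrix.of r, by ext k l; simpa [matPDeriv] using hr k l⟩

/-- First order Taylor expansion of a quotient of matrices. -/
theorem exists_mul_inv_update {g : ℕ} {ι : Type} [Fintype ι] (a : Fin n → R) (i : Fin n) (t : R)
    (I : Matrix ι (Fin g) (MvPolynomial (Fin n) ℤ))
    (A : Matrix (Fin g) (Fin g) (MvPolynomial (Fin n) ℤ))
    (hA : IsUnit (A.map (evHom a)).det)
    (hA' : IsUnit (A.map (evHom (Function.update a i (a i + t)))).det) :
    ∃ W : Matrix ι (Fin g) R, I.map (evHom (Function.update a i (a i + t))) *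
        (A.map (evHom (Function.update a i (a i + t))))⁻¹ =
      I.map (evHom a) * (A.map (evHom a))⁻¹ +
        t • ((matPDeriv i I).map (evHom a) * (A.map (evHom a))⁻¹ -
          I.map (evHom a) * (A.map (evHom a))⁻¹ *
            ((matPDeriv i A).map (evHom a) * (A.map (evHom a))⁻¹)) + t ^ 2 • W := by
  obtain ⟨V, hV⟩ := exists_map_evHom_update a i t I
  obtain ⟨U, hU⟩ := exists_map_evHom_update a i t A
  set A₁ := A.map (evHom (Function.update a i (a i + t)))
  set A₀ := A.map (evHom a)
  set I₁ := I.map (evHom (Function.update a i (a i + t)))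
  set I₀ := I.map (evHom a)
  set dA := (matPDeriv i A).map (evHom a)
  set dI := (matPDeriv i I).map (evHom a)
  set y := I₀ * A₀⁻¹ with hy
  set d := dI * A₀⁻¹ - y * (dA * A₀⁻¹) with hd
  have hy' : y * A₀ = I₀ := by rw [hy, Matrix.mul_assoc, Matrix.nonsing_inv_mul _ hA, Matrix.mul_one]
  have hd' : d * A₀ = dI - y * dA := by
    rw [hd, Matrix.sub_mul, Matrix.mul_assoc, Matrix.mul_assoc y, Matrix.mul_assoc dA,
      Matrix.nonsing_inv_mul _ hA, Matrix.mul_one, Matrix.mul_one]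
  -- The candidate y + t d is multiplied by A₁, which avoids expanding A₁⁻¹.
  have hmain : I₁ = (y + t • d) * A₁ + t ^ 2 • (V - y * U - d * dA - t • (d * U)) := by
    rw [hV, hU]
    simp only [Matrix.add_mul, Matrix.mul_add, Matrix.smul_mul, Matrix.mul_smul, hy', hd']
    ext k l
    simp only [Matrix.add_apply, Matrix.sub_apply, Matrix.smul_apply, smul_eq_mul]
    ring
  refine ⟨(V - y * U - d * dA - t • (d * U)) * A₁⁻¹, ?_⟩
  rw [hmain, Matrix.add_mul, Matrix.mul_assoc, Matrix.mul_nonsing_inv _ hA', Matrix.mul_one,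
    Matrix.smul_mul]

theorem map_matrix_inv {S : Type*} [CommRing S] {g : ℕ} (ψ : R →+* S)
    (A : Matrix (Fin g) (Fin g) R) (hA : IsUnit A.det) : A⁻¹.map ψ = (A.map ψ)⁻¹ := by
  refine (Matrix.inv_eq_right_inv ?_).symm
  rw [← Matrix.map_mul, Matrix.mul_nonsing_inv _ hA, Matrix.map_one _ (map_zero ψ) (map_one ψ)]

end Taylor

section Limits

variable {K : Type} [NontriviallyNormedField K]

/-- A function with a quadratic remainder estimate is differentiable. -/
theorem hasDerivAt_of_norm_le_sq {f : K → K} {x d : K}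
    (h : ∀ t, ‖t‖ < 1 → ‖f (x + t) - f x - t * d‖ ≤ ‖t‖ ^ 2) : HasDerivAt f d x := by
  rw [hasDerivAt_iff_isLittleO_nhds_zero]
  refine Asymptotics.IsBigO.trans_isLittleO (g := fun t : K => t ^ 2) ?_
    (Asymptotics.isLittleO_pow_id one_lt_two)
  refine Asymptotics.IsBigO.of_bound 1 ?_
  filter_upwards [Metric.ball_mem_nhds (0 : K) one_pos] with t ht
  simpa using h t (by simpa using ht)

theorem tendstoUniformlyOn_matrix {α ι κ : Type*} {F : ℕ → α → Matrix ι κ K}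
    {f : α → Matrix ι κ K} {s : Set α}
    (h : ∀ k l, TendstoUniformlyOn (fun j a => F j a k l) (fun a => f a k l) Filter.atTop s) :
    TendstoUniformlyOn F f Filter.atTop s := by
  simp only [tendstoUniformlyOn_iff_tendsto] at h ⊢
  rw [Matrix.uniformity]
  simp only [Filter.tendsto_iInf, Filter.tendsto_comap_iff]
  exact h

end Limits

/-! ### Norm estimates for the remainder. -/

section Norms

variable {n : ℕ} {K : Type} [NontriviallyNormedField K] [IsUltrametricDist K]

theorem map_evHom_map_subtype {ι κ : Type} (M : Matrix ι κ (MvPolynomial (Fin n) ℤ))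
    (a : Fin n → unitBall K) :
    (M.map (evHom a)).map (unitBall K).subtype = matEval M fun j => (a j : K) := by
  ext k l
  exact evHom_evHom (unitBall K).subtype a (M k l)

theorem isUnit_det_map_evHom_iff {g : ℕ} {A : Matrix (Fin g) (Fin g) (MvPolynomial (Fin n) ℤ)}
    {a : Fin n → unitBall K} :
    IsUnit (A.map (evHom a)).det ↔ ‖(matEval A fun j => (a j : K)).det‖ = 1 := by
  rw [isUnit_unitBall_iff, ← map_evHom_map_subtype, ← RingHom.mapMatrix_apply (unitBall K).subtype,
    ← RingHom.map_det]
  rfl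

theorem coe_update (a : Fin n → unitBall K) (i : Fin n) (x : unitBall K) :
    (fun j => (Function.update a i x j : K)) = Function.update (fun j => (a j : K)) i (x : K) := by
  ext j
  rcases eq_or_ne j i with rfl | hj
  · simp
  · simp [hj]

/-- Uniform estimate for the remainder of the first order Taylor expansion. -/
theorem norm_mul_inv_update_sub_le {g : ℕ} {ι : Type} [Fintype ι] {a : Fin n → K}
    (ha : ∀ j, ‖a j‖ ≤ 1) (i : Fin n) {t : K} (ht : ‖t‖ ≤ 1)
    (I : Matrix ι (Fin g) (MvPolynomial (Fin n) ℤ))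
    (A : Matrix (Fin g) (Fin g) (MvPolynomial (Fin n) ℤ))
    (hA : ‖(matEval A a).det‖ = 1)
    (hA' : ‖(matEval A (Function.update a i (a i + t))).det‖ = 1) (k : ι) (l : Fin g) :
    ‖(matEval I (Function.update a i (a i + t)) *
        (matEval A (Function.update a i (a i + t)))⁻¹) k l -
      (matEval I a * (matEval A a)⁻¹) k l -
      t * (matEval (matPDeriv i I) a * (matEval A a)⁻¹ -
        matEval I a * (matEval A a)⁻¹ * (matEval (matPDeriv i A) a * (matEval A a)⁻¹)) k l‖ ≤
      ‖t‖ ^ 2 := by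
  lift a to Fin n → unitBall K using ha
  lift t to unitBall K using ht
  have hupd : Function.update (fun j => (a j : K)) i ((a i : K) + (t : K)) =
      fun j => (Function.update a i (a i + t) j : K) := by
    rw [coe_update]; rfl
  rw [hupd] at hA' ⊢
  rw [← isUnit_det_map_evHom_iff] at hA hA'
  obtain ⟨W, hW⟩ := exists_mul_inv_update a i t I A hA hA'
  have h := congrArg (fun M : Matrix ι (Fin g) (unitBall K) => M.map (unitBall K).subtype) hW
  have hsub : ∀ M N : Matrix ι (Fin g) (unitBall K), (M - N).map (unitBall K).subtype =
      M.map (unitBall K).subtype - N.map (unitBall K).subtype := fun M N =>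
    Matrix.map_sub _ (map_sub _) M N
  have hadd : ∀ M N : Matrix ι (Fin g) (unitBall K), (M + N).map (unitBall K).subtype =
      M.map (unitBall K).subtype + N.map (unitBall K).subtype := fun M N =>
    Matrix.map_add _ (map_add _) M N
  have hsmul : ∀ (c : unitBall K) (M : Matrix ι (Fin g) (unitBall K)),
      (c • M).map (unitBall K).subtype = (c : K) • M.map (unitBall K).subtype := fun c M => by
    ext; simp
  simp only [hadd, hsmul, hsub, Matrix.map_mul, map_matrix_inv _ _ hA, map_matrix_inv _ _ hA',
    map_evHom_map_subtype] at h
  rw [h]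
  have h2 : ∀ X Y Z : Matrix ι (Fin g) K, ∀ c d : K,
      (X + c • Y + d • Z) k l - X k l - c * Y k l = d * Z k l := fun X Y Z c d => by
    simp only [Matrix.add_apply, Matrix.smul_apply, smul_eq_mul]
    ring
  rw [h2, norm_mul, Subring.coe_pow, norm_pow]
  exact mul_le_of_le_one_right (by positivity) (W k l).2

/-- The determinant changes by a multiple of t in the valuation ring, too small to alter its norm 1.
-/
theorem update_mem_goodPoints {F : (MvPolynomial (Fin n) ℤ)[X]} {P g : ℕ} {a : Fin n → K}
    (ha : a ∈ goodPoints K F P g) (i : Fin n) {t : K} (ht : ‖t‖ < 1) :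
    Function.update a i (a i + t) ∈ goodPoints K F P g := by
  obtain ⟨h1, h2⟩ := ha
  lift a to Fin n → unitBall K using h1
  lift t to unitBall K using ht.le
  have hupd : Function.update (fun j => (a j : K)) i ((a i : K) + (t : K)) =
      fun j => (Function.update a i (a i + t) j : K) := by
    rw [coe_update]; rfl
  rw [hupd]
  refine ⟨fun j => (Function.update a i (a i + t) j).2, ?_⟩
  rw [matEval_det] at h2 ⊢
  obtain ⟨r, hr⟩ := exists_evHom_update a i t (coeffMatrix F P g 1).det
  have h3 := fun b : Fin n → unitBall K =>
    evHom_evHom (unitBall K).subtype b (coeffMatrix F P g 1).det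
  simp only [Subring.subtype_apply] at h3
  rw [← h3] at h2 ⊢
  rw [hr, add_assoc, pow_two, mul_assoc, ← mul_add, Subring.coe_add,
    IsUltrametricDist.norm_add_eq_max_of_norm_ne_norm]
  · rw [h2, max_eq_left]
    exact (unitBall_norm_mul_le _ _).trans ht.le
  · rw [h2]
    exact ((unitBall_norm_mul_le _ _).trans_lt ht).ne'

end Norms

/-! ### Matrix limits and the derivative of the limit. -/

section Final

variable {n g p e : ℕ} {K : Type} [NontriviallyNormedField K]

theorem matEval_mul_inv_eq_rowSeq {ι : Type} {F E : (MvPolynomial (Fin n) ℤ)[X]} {P s : ℕ}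
    {B : Matrix ι (Fin g) (MvPolynomial (Fin n) ℤ)} {α : ℕ → ℤ} {k : ι}
    (hB : ∀ v, B k v = (α s : MvPolynomial (Fin n) ℤ) * coeffVec F P g s E v) (a : Fin n → K)
    (v : Fin g) :
    (matEval B a * (matEval (coeffMatrix F P g s) a)⁻¹) k v = rowSeq F E P g α s a v := by
  have h1 : matEval (coeffMatrix F P g s) a = coeffMatrix (F.map (evHom a)) P g s :=
    coeffMatrix_map (evHom a) F P g s
  have h2 : ∀ w, matEval B a k w = α s * coeffVec (F.map (evHom a)) P g s (E.map (evHom a)) w :=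
    fun w => by
      rw [coeffVec_map]
      have := congrArg (evHom a) (hB w)
      rw [map_mul, map_intCast] at this
      exact this
  rw [h1, rowSeq, rowSol, Matrix.mul_apply, Matrix.vecMul, dotProduct, Finset.mul_sum]
  exact Finset.sum_congr rfl fun w _ => by rw [h2, mul_assoc]

variable [IsUltrametricDist K]

/-- Matrices with rows proportional to coefficient vectors converge uniformly to analytic
functions, after multiplication by the inverse of `coeffMatrix`. -/
theorem exists_matrix_limit [CompleteSpace K] (hp : p.Prime) (he : 0 < e)
    (hp0 : (p : K) ≠ 0) (hp1 : ‖(p : K)‖ < 1) {F : (MvPolynomial (Fin n) ℤ)[X]}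
    (hF : F.natDegree ≤ (g + 1) * (p ^ e - 1)) {ι : Type}
    (A : ℕ → Matrix (Fin g) (Fin g) (MvPolynomial (Fin n) ℤ))
    (hA : ∀ s, 1 ≤ s → A s = coeffMatrix F (p ^ e) g s)
    (B : ℕ → Matrix ι (Fin g) (MvPolynomial (Fin n) ℤ))
    (hB : ∀ k, ∃ (E : (MvPolynomial (Fin n) ℤ)[X]) (α : ℕ → ℤ), E.coeff 0 = 0 ∧
      E.natDegree < (g + 1) * p ^ e ∧ (∀ s, 1 ≤ s → (p : ℤ) ^ s ∣ α (s + 1) - α s) ∧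
      ∀ s, 1 ≤ s → ∀ v, B s k v =
        (α s : MvPolynomial (Fin n) ℤ) * coeffVec F (p ^ e) g s E v) :
    ∃ f : (Fin n → K) → Matrix ι (Fin g) K,
      TendstoUniformlyOn (fun s a => matEval (B s) a * (matEval (A s) a)⁻¹) f
        Filter.atTop (goodPoints K F (p ^ e) g) ∧
      AnalyticOnUnitPolydiscs (goodPoints K F (p ^ e) g) f := by
  choose E α hE0 hE hα hB using hB
  choose f hf hf' using fun k v => exists_analytic_limit (K := K) hp he hp0 hp1 hF (hE0 k) (hE k)
    (hα k) v
  refine ⟨fun a => Matrix.of fun k v => f k v a, tendstoUniformlyOn_matrix fun k v => ?_,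
    fun a ha k v => hf' k v a ha⟩
  rw [Metric.tendstoUniformlyOn_iff]
  intro ε hε
  filter_upwards [(tendsto_pow_atTop_nhds_zero_of_lt_one (norm_nonneg (p : K)) hp1).eventually
    (gt_mem_nhds hε), Filter.eventually_ge_atTop 1] with s hs hs1 a ha
  rw [hA s hs1, matEval_mul_inv_eq_rowSeq (hB k s hs1), dist_eq_norm]
  exact (hf k v s hs1 a ha).trans_lt hs

/-- The derivative of the limit of `I_s A_s⁻¹`. -/
theorem hasDerivAt_limit (hp : p.Prime) (hp1 : ‖(p : K)‖ < 1)
    {F : (MvPolynomial (Fin n) ℤ)[X]}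
    (hF : F.natDegree ≤ (g + 1) * (p ^ e - 1)) {ι : Type} [Fintype ι]
    (A : ℕ → Matrix (Fin g) (Fin g) (MvPolynomial (Fin n) ℤ))
    (hA : ∀ s, 1 ≤ s → A s = coeffMatrix F (p ^ e) g s)
    (I : ℕ → Matrix ι (Fin g) (MvPolynomial (Fin n) ℤ)) (i : Fin n)
    {J J' : (Fin n → K) → Matrix ι (Fin g) K} {A' : (Fin n → K) → Matrix (Fin g) (Fin g) K}
    (hJ : TendstoUniformlyOn (fun s a => matEval (I s) a * (matEval (A s) a)⁻¹) J
        Filter.atTop (goodPoints K F (p ^ e) g))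
    (hJ' : TendstoUniformlyOn (fun s a => matEval (matPDeriv i (I s)) a * (matEval (A s) a)⁻¹) J'
        Filter.atTop (goodPoints K F (p ^ e) g))
    (hA' : TendstoUniformlyOn (fun s a => matEval (matPDeriv i (A s)) a * (matEval (A s) a)⁻¹) A'
        Filter.atTop (goodPoints K F (p ^ e) g))
    {a : Fin n → K} (ha : a ∈ goodPoints K F (p ^ e) g) (k : ι) (l : Fin g) :
    HasDerivAt (fun t => J (Function.update a i t) k l) ((J' a - J a * A' a) k l) (a i) := by
  refine hasDerivAt_of_norm_le_sq fun t ht => ?_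
  rw [Function.update_eq_self]
  have ha' := update_mem_goodPoints ha i ht
  have entry : ∀ {κ : Type} {G : ℕ → Matrix κ (Fin g) K} {L : Matrix κ (Fin g) K} (k : κ),
      Filter.Tendsto G Filter.atTop (nhds L) →
      Filter.Tendsto (fun s => G s k l) Filter.atTop (nhds (L k l)) := fun k h =>
    ((continuous_apply_apply k l).tendsto _).comp h
  have h1 := hJ.tendsto_at ha
  have h2 := hJ.tendsto_at ha'
  have h3 := hJ'.tendsto_at ha
  have h4 := hA'.tendsto_at ha
  have h5 := h3.sub (Filter.Tendsto.comp (continuous_fst.matrix_mul continuous_snd).continuousAt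
    (h1.prodMk_nhds h4))
  -- The bound |t|² does not depend on s, so pointwise convergence suffices here.
  refine le_of_tendsto (((entry k h2).sub (entry k h1)).sub ((entry k h5).const_mul t)).norm ?_
  filter_upwards [Filter.eventually_ge_atTop 1] with s hs
  have hd := norm_det_eq_one_of_mem_goodPoints hp hp1 hF ha hs
  have hd' := norm_det_eq_one_of_mem_goodPoints hp hp1 hF ha' hs
  rw [← hA s hs] at hd hd'
  exact norm_mul_inv_update_sub_le ha.1 i ht.le (I s) (A s) hd hd' k l

end Final

/-! ### Completeness of the unramified extension. -/

section Unramified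

variable (p m : ℕ) [Fact p.Prime]

theorem completeSpace_unramifiedExt (hp : 2 < p) (hm : 0 < m) :
    CompleteSpace (unramifiedExt p m) := by
  have hpos : 0 < p ^ m - 1 := by
    have := Nat.le_self_pow hm.ne' p
    omega
  have hfin : Finite {ζ : PadicAlgCl p | IsPrimitiveRoot ζ (p ^ m - 1)} := by
    classical
    refine Set.Finite.subset (Polynomial.nthRoots (p ^ m - 1) (1 : PadicAlgCl p)).toFinset.finite_toSet
      fun ζ hζ => ?_
    simpa [mem_nthRoots hpos] using IsPrimitiveRoot.pow_eq_one hζ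
  have : FiniteDimensional ℚ_[p] (unramifiedExt p m) :=
    IntermediateField.finiteDimensional_adjoin fun x _ => (Algebra.IsAlgebraic.isAlgebraic x).isIntegral
  exact FiniteDimensional.complete ℚ_[p] (unramifiedExt p m)

theorem norm_natCast_unramifiedExt_lt_one : ‖((p : ℕ) : unramifiedExt p m)‖ < 1 := by
  have h : ‖((p : ℕ) : unramifiedExt p m)‖ = ‖(p : ℚ_[p])‖ := by
    rw [← norm_algebraMap' (unramifiedExt p m) (p : ℚ_[p])]
    simp
  rw [h]
  exact Padic.norm_p_lt_one

end Unramified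

end KZ

end

theorem mainTheorem7 (p q g n e m : ℕ) [Fact p.Prime] (hq : q.Prime) (hqp : q < p)
    (he : IsLeast {k : ℕ | 0 < k ∧ p ^ k ≡ 1 [MOD q]} e)
    (hg : 0 < g) (hn : n = g * q + 1) (hne : n < p ^ e) (hpn : n + q - 2 ≤ p) (hm : 0 < m) :
    -- the entries of all matrices below are rational functions regular on the domain
    (∀ s : ℕ, 1 ≤ s → ∀ a ∈ KZ.domain n g p q e m,
      ‖(KZ.matEval (KZ.hasseWitt n g p q e s) a).det‖ = 1) ∧
    ∃ (A' : Fin n → (Fin n → KZ.unramifiedExt p m) →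
          Matrix (Fin g) (Fin g) (KZ.unramifiedExt p m))
      (J : (Fin n → KZ.unramifiedExt p m) → Matrix (Fin n) (Fin g) (KZ.unramifiedExt p m))
      (J' : Fin n → (Fin n → KZ.unramifiedExt p m) →
          Matrix (Fin n) (Fin g) (KZ.unramifiedExt p m)),
      (∀ i,
        TendstoUniformlyOn
          (fun (s : ℕ) a => KZ.matEval (KZ.matPDeriv i (KZ.hasseWitt n g p q e s)) a *
            (KZ.matEval (KZ.hasseWitt n g p q e s) a)⁻¹)
          (A' i) Filter.atTop (KZ.domain n g p q e m) ∧
        KZ.AnalyticOnUnitPolydiscs (KZ.domain n g p q e m) (A' i)) ∧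
      (TendstoUniformlyOn
          (fun (s : ℕ) a => KZ.matEval (KZ.solMatrix n g p q e s) a *
            (KZ.matEval (KZ.hasseWitt n g p q e s) a)⁻¹)
          J Filter.atTop (KZ.domain n g p q e m) ∧
        KZ.AnalyticOnUnitPolydiscs (KZ.domain n g p q e m) J) ∧
      (∀ i,
        TendstoUniformlyOn
          (fun (s : ℕ) a => KZ.matEval (KZ.matPDeriv i (KZ.solMatrix n g p q e s)) a *
            (KZ.matEval (KZ.hasseWitt n g p q e s) a)⁻¹)
          (J' i) Filter.atTop (KZ.domain n g p q e m) ∧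
        KZ.AnalyticOnUnitPolydiscs (KZ.domain n g p q e m) (J' i)) ∧
      -- the partial derivative of each entry of `J` with respect to the `i`-th variable
      (∀ i, ∀ a ∈ KZ.domain n g p q e m, ∀ k l,
        HasDerivAt (fun t => J (Function.update a i t) k l)
          ((J' i a - J a * A' i a) k l) (a i)) := by
  subst hn
  have hp : p.Prime := Fact.out
  have hq0 : 0 < q := hq.pos
  have he0 : 0 < e := he.1.1
  have hqP : q ∣ p ^ e - 1 := (Nat.modEq_iff_dvd' (Nat.one_le_pow e p hp.pos)).1 he.1.2.symm
  have hgq : g * 1 ≤ g * q := Nat.mul_le_mul_left g hq0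
  have hgP : g ≤ p ^ e := by omega
  -- The second derivative-type head needs Q^(N-2). If N ≤ 1, then p^e ≤ q + 1 ≤ gq + 1 = n, against
  -- n < p^e.
  have hN : 2 ≤ (p ^ e - 1) / q := by
    obtain ⟨N, hN⟩ := hqP
    rw [hN, Nat.mul_div_cancel_left _ hq0]
    by_contra! h
    have h1 : q * N ≤ q * 1 := Nat.mul_le_mul_left q (by omega)
    have h2 : 1 * q ≤ g * q := Nat.mul_le_mul_right q hg
    omega
  have hF := KZ.natDegree_baseFactor_le (p := p) (q := q) (e := e) (g := g) hqP hq0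
  have hA : ∀ s, 1 ≤ s → KZ.hasseWitt (g * q + 1) g p q e s =
      KZ.coeffMatrix (KZ.baseFactor (g * q + 1) p q e) (p ^ e) g s := fun s hs =>
    KZ.hasseWitt_eq hq0 hp.pos hgP hqP hs
  have hdom : KZ.domain (g * q + 1) g p q e m =
      KZ.goodPoints (KZ.unramifiedExt p m) (KZ.baseFactor (g * q + 1) p q e) (p ^ e) g := by
    rw [KZ.domain, KZ.goodPoints, hA 1 le_rfl]
  have : CompleteSpace (KZ.unramifiedExt p m) :=
    KZ.completeSpace_unramifiedExt p m (hq.two_le.trans_lt hqp) hm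
  have hp1 := KZ.norm_natCast_unramifiedExt_lt_one p m
  have hp0 : ((p : ℕ) : KZ.unramifiedExt p m) ≠ 0 := by
    simpa using hp.ne_zero
  have hcoeff : ∀ (u : ℕ) (H : Polynomial (MvPolynomial (Fin (g * q + 1)) ℤ)),
      (Polynomial.X ^ (u + 1) * H).coeff 0 = 0 := fun u H => by
    simp [Polynomial.mul_coeff_zero]
  -- Consecutive exponents differ by N P^s; c absorbs the extra 1 of the diagonal case i = j.
  have hdiv : ∀ (c : ℤ) (s : ℕ), (p : ℤ) ^ s ∣
      (-(((p ^ e) ^ (s + 1) - 1) / q : ℕ) + c) - (-(((p ^ e) ^ s - 1) / q : ℕ) + c) := by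
    intro c s
    rw [KZ.pow_sub_one_div hq0 (pow_pos hp.pos e) hqP s]
    have h1 : (p : ℤ) ^ s ∣ ((p : ℤ) ^ e) ^ s := pow_dvd_pow_of_dvd (dvd_pow_self _ he0.ne') s
    refine h1.trans ⟨-(((p ^ e - 1) / q : ℕ) : ℤ), ?_⟩
    rw [Nat.cast_add, Nat.cast_mul, Nat.cast_pow, Nat.cast_pow]
    ring
  have hdeg : ∀ (T : Finset (Fin (g * q + 1))) (T' : Finset (Fin (g * q + 1))),
      (KZ.linProd T * KZ.linProd T' * KZ.linProd Finset.univ ^ ((p ^ e - 1) / q - 2)).natDegree ≤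
        (g * q + 1) * ((p ^ e - 1) / q) := fun T T' =>
    KZ.natDegree_linProd_mul_linProd_mul_pow_le T T' hN
  have hdeg' : ∀ (T : Finset (Fin (g * q + 1))),
      (KZ.linProd T * KZ.linProd Finset.univ ^ ((p ^ e - 1) / q - 1)).natDegree ≤
        (g * q + 1) * ((p ^ e - 1) / q) := fun T =>
    KZ.natDegree_linProd_mul_pow_le T (by omega)
  have limA := fun i => KZ.exists_matrix_limit (K := KZ.unramifiedExt p m) hp he0 hp0 hp1 hF
    _ hA (fun s => KZ.matPDeriv i (KZ.hasseWitt (g * q + 1) g p q e s)) fun u =>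
      ⟨_, fun s => -(((p ^ e) ^ s - 1) / q : ℕ), hcoeff _ _,
        KZ.natDegree_row_lt hp.pos hqP hq0 u.2 (hdeg' _), fun s _ => by simpa using hdiv 0 s,
        fun s hs v => KZ.matPDeriv_hasseWitt_eq hq0 hp.pos hgP hqP hN hs i u v⟩
  have limJ := KZ.exists_matrix_limit (K := KZ.unramifiedExt p m) hp he0 hp0 hp1 hF
    _ hA (fun s => KZ.solMatrix (g * q + 1) g p q e s) fun j =>
      ⟨_, fun s => 1, hcoeff _ _, KZ.natDegree_row_lt hp.pos hqP hq0 hg (hdeg' _),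
        fun s _ => by simp, fun s hs v => by
          rw [KZ.solMatrix_eq hq0 hp.pos hgP hqP hN hs j v, Int.cast_one, one_mul]⟩
  have limJ' := fun i => KZ.exists_matrix_limit (K := KZ.unramifiedExt p m) hp he0 hp0 hp1 hF
    _ hA (fun s => KZ.matPDeriv i (KZ.solMatrix (g * q + 1) g p q e s)) fun j =>
      ⟨_, fun s => -(((p ^ e) ^ s - 1) / q : ℕ) + if i = j then 1 else 0, hcoeff _ _,
        KZ.natDegree_row_lt hp.pos hqP hq0 hg (hdeg _ _), fun s _ => hdiv _ s,
        fun s hs v => KZ.matPDeriv_solMatrix_eq hq0 hp.pos hgP hqP hN hs i j v⟩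
  choose A' hA1 hA2 using limA
  obtain ⟨J, hJ1, hJ2⟩ := limJ
  choose J' hJ1' hJ2' using limJ'
  rw [hdom]
  refine ⟨fun s hs a ha => ?_, A', J, J', fun i => ⟨hA1 i, hA2 i⟩, ⟨hJ1, hJ2⟩,
    fun i => ⟨hJ1' i, hJ2' i⟩, fun i a ha k l => ?_⟩
  · rw [hA s hs]
    exact KZ.norm_det_eq_one_of_mem_goodPoints hp hp1 hF ha hs
  · exact KZ.hasDerivAt_limit hp hp1 hF _ hA _ i hJ1 (hJ1' i) (hA1 i) ha k l
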